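/- **Setting.** Let $n\ge 2$, let $\kappa\ge 1$ be an integer with $\kappa\le n^{c}$ for a constant $c$, and let $\varepsilon\in(0,1]$. Put $L=\lfloor\log_{1+\varepsilon^3}n\rfloor$, $d_i=\lfloor(1+\varepsilon^3)^i\rfloor$ for $0\le i<L$ and $d_L=n$; the degree class of index $i$ is $[d_i,d_{i+1})$ for $i<L$ and $[n,\infty)$ for $i=L$. Let $G=(V,E)$ be a simple directed graph (no loops, no repeated edges) with $n$ vertices and $m$ edges, whose edges arrive one at a time in some order. An edge $\overrightarrow{uv}$ has head $u$ and tail $v$, and the out-degree of a vertex counts the edges of which it is the head. For an edge $e$ and a vertex $v$ let $d^{\le e}_v$ be the degree of $v$ among $e$ and the edges arriving before $e$, and let $d^{>e}_v$ and $d^{\mathrm{out},>e}_v$ be the degree and the out-degree of $v$ among the edges arriving after $e$. Fix hash functions $f_i:V\times V\to\{0,1\}$ ($0\le i\le L$) and $g:V\to[-\varepsilon,\varepsilon]$. For an endpoint $v$ of $e$ let $\tilde\imath$ be the largest $i\le L$ with $d_i\le d_v^{\le e}$. Put $\tilde d^{\le e}_v=d_{\tilde\imath}$ and $$\tilde d^{\mathrm{out},\le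 e}_v=\frac{2d_{\tilde\imath}}{\kappa}\,\bigl|\{e'\in E : e' \text{ has head } v,\ e'=e \text{ or } e' \text{ arrives before } e,\ f_{\tilde\imath}(e')=1\}\bigr| ,$$ and define the $e$-pseudobias of $v$ as $$\tilde b^e_v=\min\left\{2\,\frac{\tilde d^{\mathrm{out},\le e}_v+d^{\mathrm{out},>e}_v}{\tilde d^{\le e}_v+d^{>e}_v}-1+g(v),\ 1\right\}.$$ Given thresholds $\mathbf t\in[-1,1]^\ell$, the $i$-th bias class is $[\mathbf t_i,\mathbf t_{i+1})$ for $i<\ell$ and $[\mathbf t_\ell,1]$ for $i=\ell$. The pseudosnapshot of $G$ restricted to $E'\subseteq E$ is the $\ell\times\ell$ matrix whose $(i,j)$ entry is the number of edges $e=\overrightarrow{uv}\in E'$ such that $\tilde b^e_u$ lies in the $i$-th and $\tilde b^e_v$ in the $j$-th bias class. **Model.** A quantum streaming algorithm stores a number of qubits and classical bits between stream elements; its space is their total number. On each arrival, and once more at the end of the stream, it applies to its qubits a quantum instrument depending on the arriving element and on its classical memory, and replaces its classical memory by the outcome. It knows $n,m,\kappa,\varepsilon,\alpha,\beta,\mathbf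 t$ in advance. When an edge $e$ arrives it is given $e,f_\alpha(e),f_\beta(e)$. After the stream has ended its output is computed from its classical memory and from the values of $g$ at two vertices specified by that memory. **Statement.** Let $\alpha,\beta\in\{0,1,\dots,L\}$. There is a quantum streaming algorithm, not depending on $G$, $(f_i)$ or $g$, that uses $O(\log n)$ qubits of space (classical bits included) and whose output is an $\ell\times\ell$ real matrix with the following properties for all $G$, $(f_i)$, $g$ as above that satisfy $$\sum_{e\in E}\bigl(d_\alpha f_\alpha(e)+d_\beta f_\beta(e)\bigr)\le 2\kappa m .$$ The output is an estimate of the pseudosnapshot of $G$ restricted to the edges $e=\overrightarrow{uv}$ such that $d^{\le e}_u$ lies in the degree class of index $\alpha$ and $d^{\le e}_v$ in the degree class of index $\beta$: * for each entry, the absolute difference between its expectation (over the randomness of the algorithm) and the true entry is at most the number of those edges $e=\overrightarrow{uv}$ for which also $$\max\left\{\frac{\kappa}{2d_\alpha}\tilde d^{\mathrm{out},\le e}_u+1,\ \frac{\kappa}{2d_\beta}\tilde d^{\mathrm{out},\le e}_v+1\right\}>\kappa ;$$ * each entry has variance $O(\kappa^3m^2)$. The constant in the variance bound is absolute; the constant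 in the space bound depends only on $c$. -/

import Mathlib

open scoped Matrix

/-! ### Quantum streaming algorithms -/

/-- A quantum streaming algorithm whose stream elements have type `Token`.

Between two stream elements it stores `qubits` qubits and `bits` classical bits. When a token
`some τ` arrives (and once more, on `none`, when the stream has ended), it applies to the qubits a
quantum instrument, which depends only on the token and on the classical memory `c`, and it
overwrites the classical memory with the outcome `c'`. The instrument is given by Kraus operators:
`kraus x c c' k`, `k = 0, …, branches - 1`, are the operators belonging to the outcome `c'`.
Unitaries followed by projective measurements are the case of one operator `P * U` per outcome. -/
structure QuantumStreamAlg (Token : Type) where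
  /-- number of qubits stored -/
  qubits : ℕ
  /-- number of classical bits stored -/
  bits : ℕ
  /-- number of Kraus operators per outcome -/
  branches : ℕ
  /-- initial contents of the classical memory -/
  initMem : Fin bits → Bool
  /-- initial pure state of the qubits -/
  initState : (Fin qubits → Bool) → ℂ
  initState_norm : ∑ x, ‖initState x‖ ^ 2 = 1
  /-- the Kraus operators -/
  kraus : Option Token → (Fin bits → Bool) → (Fin bits → Bool) → Fin branches →
    Matrix (Fin qubits → Bool) (Fin qubits → Bool) ℂ
  kraus_complete : ∀ x c, ∑ c', ∑ k, (kraus x c c' k)ᴴ * kraus x c c' k = 1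

namespace QuantumStreamAlg

variable {Token : Type} (A : QuantumStreamAlg Token)

/-- The possible contents of the classical memory. -/
abbrev Mem : Type := Fin A.bits → Bool

/-- The space used, a classical bit being counted as a qubit. -/
def space : ℕ := A.qubits + A.bits

/-- A classical-quantum state: the unnormalized density matrix of the qubits for each content of
the classical memory; its trace is the probability of that content. -/
abbrev State : Type := A.Mem → Matrix (Fin A.qubits → Bool) (Fin A.qubits → Bool) ℂ

/-- The initial state. -/
def initial : A.State := fun c =>
  if c = A.initMem then Matrix.vecMulVec A.initState (star A.initState) else 0

/-- The effect of one token (or of the end-of-stream marker `none`) on the state. -/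
noncomputable def step (ρ : A.State) (x : Option Token) : A.State := fun c' =>
  ∑ c, ∑ k, A.kraus x c c' k * ρ c * (A.kraus x c c' k)ᴴ

/-- The state after the whole stream and the end-of-stream marker have been processed. -/
noncomputable def final (stream : List Token) : A.State :=
  A.step ((stream.map some).foldl A.step A.initial) none

/-- The probability that the algorithm ends with classical memory `o`. -/
noncomputable def prob (stream : List Token) (o : A.Mem) : ℝ :=
  (A.final stream o).trace.re

/-- Expectation of a function of the final classical memory. -/
noncomputable def mean (stream : List Token) (X : A.Mem → ℝ) : ℝ :=
  ∑ o, A.prob stream o * X o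

/-- Variance of a function of the final classical memory. -/
noncomputable def variance (stream : List Token) (X : A.Mem → ℝ) : ℝ :=
  ∑ o, A.prob stream o * (X o - A.mean stream X) ^ 2

end QuantumStreamAlg

/-! ### Directed graphs in the arrival order of their edges -/

/-- A simple directed graph on the vertex set `Fin n` with `m` edges, listed in order of arrival.
The edge `edge k = (u, v)` goes from `u` (its head) to `v` (its tail). -/
structure EdgeStream (n m : ℕ) where
  edge : Fin m → Fin n × Fin n
  injective : Function.Injective edge
  loopless : ∀ k, (edge k).1 ≠ (edge k).2

/-- The index `⌊log_{1+ε³} n⌋` of the last degree threshold. -/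
noncomputable def lastLevel (ε : ℝ) (n : ℕ) : ℕ := ⌊Real.logb (1 + ε ^ 3) n⌋₊

/-- The degree thresholds `d_i = ⌊(1+ε³)^i⌋` for `i < ⌊log_{1+ε³} n⌋`, the last one being `n`. -/
noncomputable def degThreshold (ε : ℝ) (n i : ℕ) : ℕ :=
  if i < lastLevel ε n then ⌊(1 + ε ^ 3) ^ i⌋₊ else n

/-- The degree `d` lies in the class `[d_i, d_{i+1})`, where the last class is `[n, ∞)`. -/
def InDegreeClass (ε : ℝ) (n i d : ℕ) : Prop :=
  degThreshold ε n i ≤ d ∧ (i < lastLevel ε n → d < degThreshold ε n (i + 1))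

/-- The largest index `i` with `d_i ≤ d` (used for `d ≥ 1` only). -/
noncomputable def degLevel (ε : ℝ) (n d : ℕ) : ℕ :=
  Nat.findGreatest (fun i => degThreshold ε n i ≤ d) (lastLevel ε n)

namespace EdgeStream

variable {n m : ℕ} (G : EdgeStream n m)

/-- Degree of `v` among the `k`-th edge and the edges before it. -/
def degUpTo (k : Fin m) (v : Fin n) : ℕ :=
  (Finset.univ.filter fun j => j ≤ k ∧ ((G.edge j).1 = v ∨ (G.edge j).2 = v)).card

/-- Degree of `v` among the edges after the `k`-th one. -/
def degAfter (k : Fin m) (v : Fin n) : ℕ :=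
  (Finset.univ.filter fun j => k < j ∧ ((G.edge j).1 = v ∨ (G.edge j).2 = v)).card

/-- Out-degree of `v` among the edges after the `k`-th one. -/
def outDegAfter (k : Fin m) (v : Fin n) : ℕ :=
  (Finset.univ.filter fun j => k < j ∧ (G.edge j).1 = v).card

/-- The degree of `v` up to the `k`-th edge, rounded down to a degree threshold. -/
noncomputable def pseudoDeg (ε : ℝ) (k : Fin m) (v : Fin n) : ℕ :=
  degThreshold ε n (degLevel ε n (G.degUpTo k v))

/-- The estimate of the out-degree of `v` up to the `k`-th edge: the number of edges with head `v`,
up to and including the `k`-th one, that are sampled by the hash function `f_i` of the level `i` of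
`v`, scaled by `2 d_i / κ`. -/
noncomputable def pseudoOutDeg (κ : ℕ) (ε : ℝ) (f : ℕ → Fin n × Fin n → Bool) (k : Fin m)
    (v : Fin n) : ℝ :=
  2 * (G.pseudoDeg ε k v : ℝ) / κ *
    ((Finset.univ.filter fun j => j ≤ k ∧ (G.edge j).1 = v ∧
      f (degLevel ε n (G.degUpTo k v)) (G.edge j) = true).card : ℝ)

/-- The pseudobias of `v` with respect to the `k`-th edge. -/
noncomputable def pseudoBias (κ : ℕ) (ε : ℝ) (f : ℕ → Fin n × Fin n → Bool) (g : Fin n → ℝ)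
    (k : Fin m) (v : Fin n) : ℝ :=
  min (2 * ((G.pseudoOutDeg κ ε f k v + G.outDegAfter k v) /
    ((G.pseudoDeg ε k v : ℝ) + G.degAfter k v)) - 1 + g v) 1

end EdgeStream

/-- The value `b` lies in the `i`-th bias class of the threshold vector `t`: in `[t_i, t_{i+1})`,
and in `[t_i, 1]` if `i` is the last index. -/
def InBiasClass {ℓ : ℕ} (t : Fin ℓ → ℝ) (i : Fin ℓ) (b : ℝ) : Prop :=
  t i ≤ b ∧ if h : (i : ℕ) + 1 < ℓ then b < t ⟨i + 1, h⟩ else b ≤ 1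

namespace EdgeStream

variable {n m : ℕ} (G : EdgeStream n m)

open scoped Classical in
/-- The pseudosnapshot of `G` restricted to the edges with arrival index in `E'`. -/
noncomputable def pseudoSnapshot (κ : ℕ) (ε : ℝ) (f : ℕ → Fin n × Fin n → Bool) (g : Fin n → ℝ)
    {ℓ : ℕ} (t : Fin ℓ → ℝ) (E' : Finset (Fin m)) : Matrix (Fin ℓ) (Fin ℓ) ℕ := fun i j =>
  (E'.filter fun k => InBiasClass t i (G.pseudoBias κ ε f g k (G.edge k).1) ∧
    InBiasClass t j (G.pseudoBias κ ε f g k (G.edge k).2)).card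

open scoped Classical in
/-- The edges whose head and tail have, on arrival of the edge, degrees in the classes of index `α`
and `β`. -/
noncomputable def classEdges (ε : ℝ) (α β : ℕ) : Finset (Fin m) :=
  Finset.univ.filter fun k => InDegreeClass ε n α (G.degUpTo k (G.edge k).1) ∧
    InDegreeClass ε n β (G.degUpTo k (G.edge k).2)

open scoped Classical in
/-- The edges of `classEdges` one of whose endpoints has too large a sampled out-degree count. -/
noncomputable def overflowEdges (κ : ℕ) (ε : ℝ) (f : ℕ → Fin n × Fin n → Bool) (α β : ℕ) :
    Finset (Fin m) :=
  (G.classEdges ε α β).filter fun k =>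
    (κ : ℝ) < max ((κ : ℝ) / (2 * degThreshold ε n α) * G.pseudoOutDeg κ ε f k (G.edge k).1 + 1)
      ((κ : ℝ) / (2 * degThreshold ε n β) * G.pseudoOutDeg κ ε f k (G.edge k).2 + 1)

/-- The stream seen by the algorithm: each edge arrives together with the values of the hash
functions `f_α` and `f_β` at that edge. -/
def hashedStream (f : ℕ → Fin n × Fin n → Bool) (α β : ℕ) :
    List ((Fin n × Fin n) × Bool × Bool) :=
  List.ofFn fun k => (G.edge k, f α (G.edge k), f β (G.edge k))

end EdgeStream

/-! The stream moves a superposition of basis labels by partial permutations. In each of two copies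
(one observed at heads with `f α`, one at tails with `f β`) a vertex owns items carrying a position
and a count. Each edge at the vertex raises the position of its items by one, and raises their count
by one when it is a sampled out-edge. New items are taken from scratch labels, all prepared with the
same amplitude `unit M`. While the scratch lasts, the amplitudes at a vertex below the observed
position are therefore `unit M` times a function of its history alone.

The difficulty is to read off the sampled count without already storing it at the vertex. Three
kinds of items are combined with signs so that their contributions at the fixed position `W - 1`
telescope (`amp_slot`). What survives is the indicator that the degree is at least the lower end of
the class and that `b` is the sampled count. Subtracting a second family, which starts at degree
`W`, restricts the degree to `[lo, W)` (`sum_kindSign_amp`).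

On arrival of an edge the head sum for count `b` and the tail sum for count `b'` are measured in
superposition with both relative signs. By polarization, the difference of the two probabilities is
proportional to the product of the two indicators (`sum_sgn_mul_sq`). Answering with plus or minus
`72 κ M` thus gives mean exactly one for an edge with the right degrees and counts. After a
detection only the later degrees of two known vertices matter, and these are counted classically, so
the pseudobiases need `g` only at those vertices. Counts of at least `κ` have no label; the edges
lost in this way are the overflow edges, and they account for the whole bias (`stepMean_eq`).

The hash hypothesis makes `M = O(κ m)` scratch blocks sufficient (`sum_cost_le`), which gives the
variance; labels and records are polynomially many in `n`, which gives the space. The running state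
is never renormalized, so the detection probabilities of different edges simply add up.
`Detector.exists_alg` turns any such norm-nonincreasing process into a streaming algorithm. -/

namespace QuantumStreamAlg

variable {Token : Type} (A : QuantumStreamAlg Token)

/-! ### Total probability and second moments -/

theorem sum_trace_step (ρ : A.State) (x : Option Token) :
    ∑ c', (A.step ρ x c').trace = ∑ c, (ρ c).trace := by
  simp only [step, Matrix.trace_sum]
  rw [Finset.sum_comm]
  refine Finset.sum_congr rfl fun c _ => ?_
  have h : ∀ c' k, (A.kraus x c c' k * ρ c * (A.kraus x c c' k)ᴴ).trace =
      ((A.kraus x c c' k)ᴴ * A.kraus x c c' k * ρ c).trace := fun c' k => by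
    rw [Matrix.trace_mul_cycle]
  simp only [h, ← Matrix.trace_sum, ← Finset.sum_mul, A.kraus_complete x c, one_mul]

theorem sum_trace_foldl (l : List (Option Token)) (ρ : A.State) :
    ∑ c, (l.foldl A.step ρ c).trace = ∑ c, (ρ c).trace := by
  induction l generalizing ρ with
  | nil => rfl
  | cons x l ih => rw [List.foldl_cons, ih, sum_trace_step]

theorem sum_prob (l : List Token) : ∑ o, A.prob l o = 1 := by
  have h : ∑ o, (A.final l o).trace = 1 := by
    rw [final, sum_trace_step, sum_trace_foldl]
    have h0 : ∀ c, (A.initial c).trace =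
        if c = A.initMem then ∑ x, ((‖A.initState x‖ ^ 2 : ℝ) : ℂ) else 0 := by
      intro c
      unfold initial
      split_ifs
      · simp [Matrix.trace, Matrix.vecMulVec_apply, Complex.mul_conj, Complex.normSq_eq_norm_sq]
      · simp
    simp only [h0, Finset.sum_ite_eq', Finset.mem_univ, if_true]
    rw [← Complex.ofReal_sum, A.initState_norm, Complex.ofReal_one]
  simp only [prob, ← Complex.re_sum, h, Complex.one_re]

theorem variance_le_mean_sq (l : List Token) (X : A.Mem → ℝ) :
    A.variance l X ≤ A.mean l (fun o => X o ^ 2) := by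
  have h : A.variance l X = A.mean l (fun o => X o ^ 2) - A.mean l X ^ 2 := by
    unfold variance
    generalize hμ : A.mean l X = μ
    have e : ∀ o, A.prob l o * (X o - μ) ^ 2 =
        A.prob l o * X o ^ 2 - 2 * μ * (A.prob l o * X o) + μ ^ 2 * A.prob l o := fun o => by ring
    simp only [e, Finset.sum_add_distrib, Finset.sum_sub_distrib, ← Finset.mul_sum, sum_prob]
    have : ∑ o, A.prob l o * X o = μ := hμ
    rw [this]
    unfold mean
    ring
  rw [h]
  linarith [sq_nonneg (A.mean l X)]

end QuantumStreamAlg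

/-! ### From norm-nonincreasing processes to quantum instruments -/

theorem sum_norm_sq_eq_re_dotProduct {B : Type*} [Fintype B] (x : B → ℂ) :
    star x ⬝ᵥ x = ((∑ y, ‖x y‖ ^ 2 : ℝ) : ℂ) := by
  simp [dotProduct, Complex.conj_mul']

open scoped ComplexOrder MatrixOrder Matrix.Norms.L2Operator in
/-- A finite family of matrices that does not increase the total squared norm is completed to a
family of Kraus operators by one more matrix. -/
theorem exists_kraus_complement {B ι : Type*} [Fintype B] [DecidableEq B] [Fintype ι]
    (K : ι → Matrix B B ℂ)
    (h : ∀ x : B → ℂ, ∑ i, ∑ y, ‖(K i *ᵥ x) y‖ ^ 2 ≤ ∑ y, ‖x y‖ ^ 2) :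
    ∃ S : Matrix B B ℂ, Sᴴ * S + ∑ i, (K i)ᴴ * K i = 1 := by
  have hpos : (1 - ∑ i, (K i)ᴴ * K i).PosSemidef := by
    refine Matrix.PosSemidef.of_dotProduct_mulVec_nonneg ?_ fun x => ?_
    · rw [Matrix.IsHermitian, Matrix.conjTranspose_sub, Matrix.conjTranspose_one,
        Matrix.conjTranspose_sum]
      simp
    · have e : star x ⬝ᵥ ((1 - ∑ i, (K i)ᴴ * K i) *ᵥ x) =
          ((∑ y, ‖x y‖ ^ 2 - ∑ i, ∑ y, ‖(K i *ᵥ x) y‖ ^ 2 : ℝ) : ℂ) := by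
        rw [Matrix.sub_mulVec, Matrix.one_mulVec, dotProduct_sub, Matrix.sum_mulVec,
          dotProduct_sum, Complex.ofReal_sub, ← sum_norm_sq_eq_re_dotProduct, Complex.ofReal_sum]
        congr 1
        refine Finset.sum_congr rfl fun i _ => ?_
        rw [← sum_norm_sq_eq_re_dotProduct, Matrix.star_mulVec, ← Matrix.mulVec_mulVec,
          Matrix.dotProduct_mulVec]
      rw [e]
      exact_mod_cast sub_nonneg.2 (h x)
  -- The quadratic form of the deficit is the norm lost by the family, hence nonnegative; any
  -- factorization of the deficit serves as the missing operator.
  obtain ⟨S, hS⟩ := CStarAlgebra.nonneg_iff_eq_star_mul_self.1 hpos.nonneg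
  exact ⟨S, by rw [← Matrix.star_eq_conjTranspose S, ← hS]; abel⟩

/-- A streaming process on the span of `Λ`: each token either leaves the process running, with
state changed by `run`, or is detected with result `d`, with amplitude given by `detect`. After a
detection only the classical record `d` is updated. -/
structure Detector (Token Λ D : Type) [Fintype Λ] [Fintype D] where
  run : Token → Matrix Λ Λ ℂ
  detect : Token → D → Λ → ℂ
  contraction : ∀ t x, ∑ y, ‖(run t *ᵥ x) y‖ ^ 2 + ∑ d, ‖detect t d ⬝ᵥ x‖ ^ 2 ≤ ∑ y, ‖x y‖ ^ 2
  update : D → Token → D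
  start : Λ → ℂ
  start_norm : ∑ x, ‖start x‖ ^ 2 = 1

namespace Detector

set_option linter.unusedSectionVars false

variable {Token Λ B D : Type} [Fintype Λ] [Fintype B] [Fintype D]

/-- The expected value of a function of the final record (zero without detection). -/
noncomputable def detectSum (P : Detector Token Λ D) (X : D → ℝ) : (Λ → ℂ) → List Token → ℝ
  | _, [] => 0
  | ψ, t :: l => ∑ d, ‖P.detect t d ⬝ᵥ ψ‖ ^ 2 * X (l.foldl P.update d) +
      P.detectSum X (P.run t *ᵥ ψ) l

variable [DecidableEq B] [DecidableEq D]

/-- The isometry of an embedding of basis labels. -/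
def embMatrix (e : Λ ↪ B) : Matrix B Λ ℂ := fun b x => if b = e x then 1 else 0

theorem embMatrix_conjTranspose_mulVec (e : Λ ↪ B) (x : B → ℂ) :
    (embMatrix e)ᴴ *ᵥ x = x ∘ e := by
  ext y
  simp [embMatrix, Matrix.mulVec, dotProduct, Matrix.conjTranspose_apply, apply_ite]

theorem embMatrix_mulVec_apply (e : Λ ↪ B) (x : Λ → ℂ) :
    (embMatrix e *ᵥ x) ∘ e = x := by
  classical
  ext y
  simp [embMatrix, Matrix.mulVec, dotProduct]

theorem sum_norm_embMatrix_mulVec (e : Λ ↪ B) (x : Λ → ℂ) :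
    ∑ b, ‖(embMatrix e *ᵥ x) b‖ ^ 2 = ∑ y, ‖x y‖ ^ 2 := by
  have h : star (embMatrix e *ᵥ x) ⬝ᵥ (embMatrix e *ᵥ x) = star x ⬝ᵥ x := by
    rw [Matrix.star_mulVec, ← Matrix.dotProduct_mulVec, embMatrix_conjTranspose_mulVec,
      embMatrix_mulVec_apply]
  rw [sum_norm_sq_eq_re_dotProduct, sum_norm_sq_eq_re_dotProduct] at h
  exact_mod_cast h

/-- Transport of a process along an embedding of basis labels. -/
def map (P : Detector Token Λ D) (e : Λ ↪ B) : Detector Token B D where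
  run t := embMatrix e * P.run t * (embMatrix e)ᴴ
  detect t d := P.detect t d ᵥ* (embMatrix e)ᴴ
  contraction t x := by
    have h1 : (embMatrix e * P.run t * (embMatrix e)ᴴ) *ᵥ x =
        embMatrix e *ᵥ (P.run t *ᵥ (x ∘ e)) := by
      rw [← Matrix.mulVec_mulVec, ← Matrix.mulVec_mulVec, embMatrix_conjTranspose_mulVec]
    have h2 : ∀ d, (P.detect t d ᵥ* (embMatrix e)ᴴ) ⬝ᵥ x = P.detect t d ⬝ᵥ (x ∘ e) := fun d => by
      rw [← Matrix.dotProduct_mulVec, embMatrix_conjTranspose_mulVec]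
    rw [h1, sum_norm_embMatrix_mulVec]
    simp only [h2]
    refine (P.contraction t (x ∘ e)).trans ?_
    have := Finset.sum_le_univ_sum_of_nonneg (s := Finset.univ.map e) (f := fun y => ‖x y‖ ^ 2)
      (fun y => by positivity)
    simpa using this
  update := P.update
  start := embMatrix e *ᵥ P.start
  start_norm := by rw [sum_norm_embMatrix_mulVec, P.start_norm]

theorem detectSum_map (P : Detector Token Λ D) (e : Λ ↪ B) (X : D → ℝ) (l : List Token)
    (ψ : Λ → ℂ) : (P.map e).detectSum X (embMatrix e *ᵥ ψ) l = P.detectSum X ψ l := by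
  induction l generalizing ψ with
  | nil => rfl
  | cons t l ih =>
    have h1 : (P.map e).run t *ᵥ (embMatrix e *ᵥ ψ) = embMatrix e *ᵥ (P.run t *ᵥ ψ) := by
      simp only [map]
      rw [← Matrix.mulVec_mulVec, ← Matrix.mulVec_mulVec, embMatrix_conjTranspose_mulVec,
        embMatrix_mulVec_apply]
    have h2 : ∀ d, (P.map e).detect t d ⬝ᵥ (embMatrix e *ᵥ ψ) = P.detect t d ⬝ᵥ ψ := fun d => by
      simp only [map]
      rw [← Matrix.dotProduct_mulVec, embMatrix_conjTranspose_mulVec, embMatrix_mulVec_apply]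
    simp only [detectSum, h1, h2, ih]
    rfl

/-- A detection is a rank-one operator that resets the qubits to `b₀`, so its norm is the detection
amplitude. The contraction property then leaves room for one further outcome absorbing the lost
norm. -/
theorem exists_dead (P : Detector Token B D) (b₀ : B) (t : Token) :
    ∃ S : Matrix B B ℂ, Sᴴ * S + ((P.run t)ᴴ * P.run t +
      ∑ d, (Matrix.vecMulVec (Pi.single b₀ 1) (P.detect t d))ᴴ *
        Matrix.vecMulVec (Pi.single b₀ 1) (P.detect t d)) = 1 := by
  obtain ⟨S, hS⟩ := exists_kraus_complement (ι := Option D) (fun o => match o with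
    | none => P.run t
    | some d => Matrix.vecMulVec (Pi.single b₀ 1) (P.detect t d)) (fun x => by
      rw [Fintype.sum_option]
      refine le_trans (le_of_eq ?_) (P.contraction t x)
      congr 1
      refine Finset.sum_congr rfl fun d _ => ?_
      rw [Finset.sum_eq_single b₀]
      · simp [Matrix.vecMulVec_mulVec]
      · intro y _ hy
        simp [Matrix.vecMulVec_mulVec, hy]
      · simp)
  refine ⟨S, ?_⟩
  rw [Fintype.sum_option] at hS
  exact hS

/-- The Kraus operators that complete the instrument of a running process. -/
noncomputable def dead (P : Detector Token B D) (b₀ : B) (t : Token) : Matrix B B ℂ :=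
  (P.exists_dead b₀ t).choose

theorem dead_spec (P : Detector Token B D) (b₀ : B) (t : Token) :
    (P.dead b₀ t)ᴴ * P.dead b₀ t + ((P.run t)ᴴ * P.run t +
      ∑ d, (Matrix.vecMulVec (Pi.single b₀ 1) (P.detect t d))ᴴ *
        Matrix.vecMulVec (Pi.single b₀ 1) (P.detect t d)) = 1 :=
  (P.exists_dead b₀ t).choose_spec

/-- The instrument of a process. The classical memory `none` means running, `some none` stopped
without result, `some (some d)` stopped with the record `d`. -/
noncomputable def instr (P : Detector Token B D) (b₀ : B) :
    Option Token → Option (Option D) → Option (Option D) → Matrix B B ℂ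
  | none, c, c' => if c' = c then 1 else 0
  | some t, none, none => P.run t
  | some t, none, some none => P.dead b₀ t
  | some t, none, some (some d) => Matrix.vecMulVec (Pi.single b₀ 1) (P.detect t d)
  | some _, some none, c' => if c' = some none then 1 else 0
  | some t, some (some d), c' => if c' = some (some (P.update d t)) then 1 else 0

theorem sum_instr (P : Detector Token B D) (b₀ : B) (x : Option Token) (c : Option (Option D)) :
    ∑ c', (P.instr b₀ x c c')ᴴ * P.instr b₀ x c c' = 1 := by
  have key : ∀ c₀ : Option (Option D), ∑ c', (if c' = c₀ then (1 : Matrix B B ℂ) else 0)ᴴ *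
      (if c' = c₀ then 1 else 0) = 1 := fun c₀ => by
    rw [Finset.sum_eq_single c₀]
    · simp
    · intro c' _ h
      simp [h]
    · simp
  rcases x with _ | t
  · exact key c
  · rcases c with _ | _ | d
    · rw [Fintype.sum_option, Fintype.sum_option, ← P.dead_spec b₀ t]
      simp only [instr]
      abel
    · exact key _
    · exact key _

/-- The effect of one token on the joint state, the classical memory being written out. -/
noncomputable def astep (P : Detector Token B D) (b₀ : B)
    (ρ : Option (Option D) → Matrix B B ℂ) (x : Option Token) :
    Option (Option D) → Matrix B B ℂ := fun c' =>
  ∑ c, P.instr b₀ x c c' * ρ c * (P.instr b₀ x c c')ᴴ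

/-- Value of a function of the record, extended by zero. -/
def val (X : D → ℝ) (c : Option (Option D)) : ℝ := c.join.elim 0 X

/-- Only `run` leads into the memory `none`, so the running branch stays an unnormalized pure state
and a single vector describes it. -/
theorem astep_run (P : Detector Token B D) (b₀ : B) (ρ : Option (Option D) → Matrix B B ℂ)
    (t : Token) {ψ : B → ℂ} (h : ρ none = Matrix.vecMulVec ψ (star ψ)) :
    P.astep b₀ ρ (some t) none =
      Matrix.vecMulVec (P.run t *ᵥ ψ) (star (P.run t *ᵥ ψ)) := by
  simp only [astep, Fintype.sum_option, instr, h, reduceCtorEq, if_false, zero_mul,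
    Finset.sum_const_zero, add_zero]
  rw [Matrix.mul_vecMulVec, Matrix.vecMulVec_mul, Matrix.star_mulVec]

theorem trace_astep_detect (P : Detector Token B D) (b₀ : B)
    (ρ : Option (Option D) → Matrix B B ℂ)
    (t : Token) {ψ : B → ℂ} (h : ρ none = Matrix.vecMulVec ψ (star ψ)) (d' : D) :
    (P.astep b₀ ρ (some t) (some (some d'))).trace = ((‖P.detect t d' ⬝ᵥ ψ‖ ^ 2 : ℝ) : ℂ) +
      ∑ d, if d' = P.update d t then (ρ (some (some d))).trace else 0 := by
  simp only [astep, Fintype.sum_option, instr, h, reduceCtorEq, Option.some.injEq, if_false,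
    zero_mul, zero_add, Matrix.trace_add, Matrix.trace_sum]
  congr 1
  · rw [Matrix.mul_vecMulVec, Matrix.vecMulVec_mul, ← Matrix.star_mulVec,
      Matrix.vecMulVec_mulVec, Matrix.trace_vecMulVec, dotProduct_comm,
      sum_norm_sq_eq_re_dotProduct]
    congr 1
    rw [Finset.sum_eq_single b₀]
    · simp
    · intro y _ hy
      simp [hy]
    · simp
  · refine Finset.sum_congr rfl fun d _ => ?_
    split_ifs <;> simp

/-- Once a record exists its weight is preserved and it evolves deterministically, and branches
stopped without a record have value zero. Only fresh detections from the running vector add to the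
mean. -/
theorem sum_trace_foldl_astep (P : Detector Token B D) (b₀ : B) (X : D → ℝ) (l : List Token)
    (ρ : Option (Option D) → Matrix B B ℂ) (ψ : B → ℂ)
    (h : ρ none = Matrix.vecMulVec ψ (star ψ)) :
    ∑ c, ((l.map some).foldl (P.astep b₀) ρ c).trace.re * val X c =
      ∑ d, (ρ (some (some d))).trace.re * X (l.foldl P.update d) + P.detectSum X ψ l := by
  induction l generalizing ρ ψ with
  | nil => simp [detectSum, val, Fintype.sum_option]
  | cons t l ih =>
    rw [List.map_cons, List.foldl_cons, ih _ _ (P.astep_run b₀ ρ t h), detectSum, ← add_assoc]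
    congr 1
    simp only [P.trace_astep_detect b₀ ρ t h, Complex.add_re, Complex.ofReal_re, add_mul,
      Finset.sum_add_distrib]
    rw [add_comm]
    congr 1
    simp only [Complex.re_sum, Finset.sum_mul]
    rw [Finset.sum_comm]
    refine Finset.sum_congr rfl fun d _ => ?_
    rw [Finset.sum_eq_single (P.update d t)]
    · simp
    · intro d' _ hd
      simp [hd]
    · simp

theorem astep_none (P : Detector Token B D) (b₀ : B) (ρ : Option (Option D) → Matrix B B ℂ) :
    P.astep b₀ ρ none = ρ := by
  ext1 c
  simp only [astep, instr]
  rw [Finset.sum_eq_single c]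
  · simp
  · intro c' _ h
    simp [h.symm]
  · simp

end Detector

/-! ### Coding a process in qubits and classical bits -/

theorem sum_range_code {M C β : Type*} [Fintype M] [Fintype C] [DecidableEq M] [DecidableEq C]
    [AddCommMonoid β] {enc : C → M} {dec : M → C} (h : ∀ c, dec (enc c) = c) (f : C → β) :
    ∑ m, (if enc (dec m) = m then f (dec m) else 0) = ∑ c, f c := by
  rw [← Finset.sum_filter]
  refine (Finset.sum_bij (fun c _ => enc c) ?_ ?_ ?_ ?_).symm
  · intro c _
    simp [h]
  · intro a _ b _ hab
    rw [← h a, hab, h]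
  · intro m hm
    exact ⟨dec m, Finset.mem_univ _, (Finset.mem_filter.1 hm).2⟩
  · intro c _
    rw [h]

namespace Detector

variable {Token Λ D : Type} [Fintype Λ] [Fintype D] [DecidableEq D]

/-- The streaming algorithm that runs a process on qubits. -/
noncomputable def toAlg {q b : ℕ} (P : Detector Token (Fin q → Bool) D)
    (enc : Option (Option D) → Fin b → Bool) (dec : (Fin b → Bool) → Option (Option D))
    (h : ∀ c, dec (enc c) = c) : QuantumStreamAlg Token where
  qubits := q
  bits := b
  branches := 1
  initMem := enc none
  initState := P.start
  initState_norm := P.start_norm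
  kraus x c c' _ := if enc (dec c') = c' then P.instr (fun _ => false) x (dec c) (dec c') else 0
  kraus_complete x c := by
    rw [← P.sum_instr (fun _ => false) x (dec c), ← sum_range_code h]
    refine Finset.sum_congr rfl fun c' _ => ?_
    split_ifs <;> simp

/-- `A` carries out the process `P`, the classical memory being coded by `enc` and `dec`. -/
structure Simulates (A : QuantumStreamAlg Token) (P : Detector Token (Fin A.qubits → Bool) D)
    (enc : Option (Option D) → A.Mem) (dec : A.Mem → Option (Option D)) : Prop where
  dec_enc : ∀ c, dec (enc c) = c
  initMem : A.initMem = enc none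
  initState : A.initState = P.start
  kraus : ∀ x c c' M, ∑ k, A.kraus x c c' k * M * (A.kraus x c c' k)ᴴ =
    if enc (dec c') = c' then P.instr (fun _ => false) x (dec c) (dec c') * M *
      (P.instr (fun _ => false) x (dec c) (dec c'))ᴴ else 0

theorem toAlg_simulates {q b : ℕ} (P : Detector Token (Fin q → Bool) D)
    (enc : Option (Option D) → Fin b → Bool) (dec : (Fin b → Bool) → Option (Option D))
    (h : ∀ c, dec (enc c) = c) : Simulates (P.toAlg enc dec h) P enc dec where
  dec_enc := h
  initMem := rfl
  initState := rfl
  kraus x c c' M := by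
    have key : ∀ (p : Prop) [Decidable p] (K M : Matrix (Fin q → Bool) (Fin q → Bool) ℂ),
        ∑ _k : Fin 1, (if p then K else 0) * M * (if p then K else 0)ᴴ =
          if p then K * M * Kᴴ else 0 := fun p _ K M => by
      split_ifs <;> simp
    exact @key _ (_) _ M

namespace Simulates

variable {A : QuantumStreamAlg Token} {P : Detector Token (Fin A.qubits → Bool) D}
  {enc : Option (Option D) → A.Mem} {dec : A.Mem → Option (Option D)}

/-- The state of `A`, summed over the codes of each content of the classical memory. -/
noncomputable def marginal (dec : A.Mem → Option (Option D)) (ρ : A.State)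
    (c : Option (Option D)) : Matrix (Fin A.qubits → Bool) (Fin A.qubits → Bool) ℂ :=
  ∑ m, if dec m = c then ρ m else 0

/-- Every outcome written is a codeword and the old memory enters only through `dec`; initial or
intermediate non-codewords therefore need no separate treatment. -/
theorem marginal_step (S : Simulates A P enc dec) (ρ : A.State) (x : Option Token) :
    marginal dec (A.step ρ x) = P.astep (fun _ => false) (marginal dec ρ) x := by
  ext1 γ
  have e1 : marginal dec (A.step ρ x) γ = ∑ m, P.instr (fun _ => false) x (dec m) γ * ρ m *
        (P.instr (fun _ => false) x (dec m) γ)ᴴ := by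
    unfold marginal
    rw [Finset.sum_eq_single (enc γ)]
    · simp [QuantumStreamAlg.step, S.kraus, S.dec_enc]
    · intro m _ hm
      split_ifs with hd
      · have : enc (dec m) ≠ m := fun hc => hm (by rw [← hc, hd])
        simp [QuantumStreamAlg.step, S.kraus, this]
      · rfl
    · simp
  rw [e1, astep]
  simp only [marginal, Finset.mul_sum, Finset.sum_mul]
  rw [Finset.sum_comm]
  refine Finset.sum_congr rfl fun m _ => ?_
  rw [Finset.sum_eq_single (dec m)]
  · simp
  · intro c _ hc
    simp [hc.symm]
  · simp

theorem marginal_foldl (S : Simulates A P enc dec) (l : List (Option Token)) (ρ : A.State) :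
    marginal dec (l.foldl A.step ρ) =
      l.foldl (P.astep (fun _ => false)) (marginal dec ρ) := by
  induction l generalizing ρ with
  | nil => rfl
  | cons x l ih => rw [List.foldl_cons, List.foldl_cons, ih, S.marginal_step]

theorem mean_eq (S : Simulates A P enc dec) (X : D → ℝ) (l : List Token) :
    A.mean l (fun o => val X (dec o)) = P.detectSum X P.start l := by
  have e1 : A.mean l (fun o => val X (dec o)) =
      ∑ c, (marginal dec (A.final l) c).trace.re * val X c := by
    simp only [marginal, Matrix.trace_sum, Complex.re_sum, Finset.sum_mul]
    rw [Finset.sum_comm]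
    refine Finset.sum_congr rfl fun m _ => ?_
    rw [Finset.sum_eq_single (dec m)]
    · simp [QuantumStreamAlg.prob]
    · intro c _ hc
      simp [hc.symm]
    · simp
  have h0 : ∀ c, marginal dec A.initial c =
      if c = none then Matrix.vecMulVec P.start (star P.start) else 0 := by
    intro c
    unfold marginal
    rw [Finset.sum_eq_single (enc none)]
    · simp [QuantumStreamAlg.initial, S.initMem, S.initState, S.dec_enc, eq_comm]
    · intro m _ hm
      simp [QuantumStreamAlg.initial, S.initMem, hm]
    · simp
  rw [e1, QuantumStreamAlg.final, S.marginal_step, S.marginal_foldl, astep_none,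
    P.sum_trace_foldl_astep _ X l _ P.start (by simp [h0])]
  simp [h0]

end Simulates

/-- Every process is carried out by a streaming algorithm with logarithmically many qubits and
bits. -/
theorem exists_alg (P : Detector Token Λ D) :
    ∃ (A : QuantumStreamAlg Token) (dec : A.Mem → Option D),
      A.space = Nat.clog 2 (Fintype.card Λ) + Nat.clog 2 (Fintype.card D + 2) ∧
      ∀ (X : D → ℝ) (l : List Token),
        A.mean l (fun o => (dec o).elim 0 X) = P.detectSum X P.start l := by
  have h1 : Fintype.card Λ ≤ Fintype.card (Fin (Nat.clog 2 (Fintype.card Λ)) → Bool) := by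
    simpa using Nat.le_pow_clog one_lt_two _
  have h2 : Fintype.card (Option (Option D)) ≤
      Fintype.card (Fin (Nat.clog 2 (Fintype.card D + 2)) → Bool) := by
    have := Nat.le_pow_clog one_lt_two (Fintype.card D + 2)
    simpa only [Fintype.card_option, Fintype.card_fun, Fintype.card_bool, Fintype.card_fin]
  obtain ⟨e⟩ := Function.Embedding.nonempty_of_card_le h1
  obtain ⟨enc⟩ := Function.Embedding.nonempty_of_card_le h2
  have h := Function.leftInverse_invFun enc.injective
  refine ⟨(P.map e).toAlg enc (Function.invFun enc) h,
    fun o => (Function.invFun enc o).join, rfl, fun X l => ?_⟩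
  rw [← P.detectSum_map e]
  exact (toAlg_simulates _ _ _ h).mean_eq X l

end Detector

/-! ### Amplitudes of the items of a vertex

The history of a vertex lists, most recent first, for each edge at the vertex whether it is counted.
-/

/-- Number of counted edges among the `i` most recent ones. -/
def cnt (H : List Bool) (i : ℕ) : ℕ := (H.take i).count true

theorem cnt_zero (H : List Bool) : cnt H 0 = 0 := by simp [cnt]

theorem cnt_cons (h : Bool) (H : List Bool) (i : ℕ) :
    cnt (h :: H) (i + 1) = h.toNat + cnt H i := by
  cases h <;> simp [cnt, add_comm]

theorem cnt_succ (H : List Bool) (i : ℕ) : cnt H (i + 1) = cnt H i + (H.getD i false).toNat := by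
  induction H generalizing i with
  | nil => simp [cnt]
  | cons h H ih =>
    cases i with
    | zero => cases h <;> simp [cnt]
    | succ i => rw [cnt_cons, cnt_cons, ih, List.getD_cons_succ, add_assoc]

theorem cnt_of_length_le {H : List Bool} {i : ℕ} (h : H.length ≤ i) : cnt H i = H.count true := by
  rw [cnt, List.take_of_length_le h]

theorem cnt_min_length (H : List Bool) (i : ℕ) : cnt H (min H.length i) = cnt H i := by
  rcases le_total H.length i with h | h
  · rw [min_eq_left h, cnt_of_length_le le_rfl, cnt_of_length_le h]
  · rw [min_eq_right h]

/-- Amplitude at position `q` and count `b` of the items of kind `τ` with birth position `β`. Items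
of kind `none` are created by every edge of the vertex, items of kind `some δ` by the counted
edges. -/
def amp (β : ℕ) : Option Bool → List Bool → ℕ → ℕ → ℝ
  | none, H, q, b => if β ≤ q ∧ q < β + H.length ∧ b = cnt H (q - β) then 1 else 0
  | some δ, H, q, b => ∑ i ∈ Finset.range H.length,
      if H.getD i false = true ∧ i ≤ q ∧ q ≤ β + i ∧ b = cnt H i + δ.toNat then 1 else 0

/-- The places where an edge with counting flag `h` creates items. -/
def IsBirth (β : ℕ) (h : Bool) : Option Bool → ℕ → ℕ → Prop
  | none, q, b => q = β ∧ b = 0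
  | some δ, q, b => h = true ∧ q ≤ β ∧ b = δ.toNat

theorem amp_nil (β : ℕ) (τ : Option Bool) (q b : ℕ) : amp β τ [] q b = 0 := by
  cases τ with
  | none => simp only [amp, List.length_nil]; exact if_neg (by omega)
  | some δ => simp [amp]

-- This is the recursion that the sketch implements: birth, or a shift by one position and by the
-- flag. The two never meet at one label, since older items of kind `none` lie beyond `β`, and older
-- items of kind `some δ` have count above `δ` after a counted edge.
open scoped Classical in
theorem amp_cons (β : ℕ) (τ : Option Bool) (h : Bool) (H : List Bool) (q b : ℕ) :
    amp β τ (h :: H) q b = if IsBirth β h τ q b then 1 else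
      if 1 ≤ q ∧ h.toNat ≤ b then amp β τ H (q - 1) (b - h.toNat) else 0 := by
  cases τ with
  | none =>
    have hI : IsBirth β h none q b ↔ q = β ∧ b = 0 := Iff.rfl
    simp only [amp, List.length_cons]
    by_cases hq : β < q
    · obtain ⟨j, rfl⟩ : ∃ j, q = β + j + 1 := ⟨q - β - 1, by omega⟩
      have e1 : β + j + 1 - β = j + 1 := by omega
      have e2 : β + j + 1 - 1 - β = j := by omega
      rw [e1, e2, cnt_cons, if_neg (fun hc => by have := hI.1 hc; omega :
        ¬ IsBirth β h none (β + j + 1) b), ← ite_and]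
      congr 1
      apply propext
      omega
    · by_cases hq' : q = β
      · subst hq'
        rw [Nat.sub_self, cnt_zero]
        by_cases hb : b = 0
        · rw [if_pos (hI.2 ⟨rfl, hb⟩), if_pos ⟨le_rfl, by omega, hb⟩]
        · rw [if_neg (fun hc => hb (hI.1 hc).2), if_neg (fun hc => hb hc.2.2), ← ite_and,
            if_neg (fun hc => by omega)]
      · rw [if_neg (fun hc => hq' (hI.1 hc).1), if_neg (fun hc => by omega), ← ite_and,
          if_neg (fun hc => by omega)]
  | some δ =>
    have hI : IsBirth β h (some δ) q b ↔ h = true ∧ q ≤ β ∧ b = δ.toNat := Iff.rfl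
    simp only [amp, List.length_cons]
    rw [Finset.sum_range_succ']
    simp only [List.getD_cons_succ, List.getD_cons_zero, cnt_cons, cnt_zero, zero_le, true_and,
      zero_add, add_zero]
    by_cases hB : h = true ∧ q ≤ β ∧ b = δ.toNat
    · rw [if_pos hB, if_pos (hI.2 hB), Finset.sum_eq_zero, zero_add]
      intro i _
      rw [if_neg]
      rintro ⟨-, -, -, hb⟩
      rw [hB.1, Bool.toNat_true] at hb
      omega
    · rw [if_neg hB, if_neg (mt hI.1 hB), add_zero]
      split_ifs with hc
      · refine Finset.sum_congr rfl fun i _ => ?_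
        congr 1
        apply propext
        refine and_congr_right fun _ => ?_
        omega
      · refine Finset.sum_eq_zero fun i _ => ?_
        rw [if_neg]
        rintro ⟨-, h1, -, h2⟩
        exact hc (by omega)

theorem sum_range_telescope (f : ℕ → ℝ) {a W : ℕ} (haW : a ≤ W) (d : ℕ) :
    ∑ i ∈ Finset.range d, (if a ≤ i ∧ i < W then f (i + 1) - f i else 0) =
      f (max a (min d W)) - f a := by
  induction d with
  | zero => simp
  | succ d ih =>
    rw [Finset.sum_range_succ, ih]
    split_ifs with h
    · rw [min_eq_left h.2.le, max_eq_right h.1, min_eq_left (show d + 1 ≤ W by omega),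
        max_eq_right (by omega)]
      ring
    · have : max a (min (d + 1) W) = max a (min d W) := by omega
      rw [this, add_zero]

/-- At position `W - 1` the item of kind `none` was born `s - 1` edges ago and shows `cnt H (s -
1)`. The counted edges with age `i` in `[s - 1, W)` contribute the differences between the
indicators of `cnt H (i + 1)` and `cnt H i`; uncounted ones would contribute zero anyway. The sum
telescopes to `cnt H W`. -/
theorem amp_slot {W s : ℕ} (hs : 1 ≤ s) (hsW : s ≤ W) (H : List Bool) (b : ℕ) :
    amp (W - s) none H (W - 1) b + amp (W - s) (some true) H (W - 1) b
      - amp (W - s) (some false) H (W - 1) b =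
      if s ≤ H.length ∧ b = cnt H W then 1 else 0 := by
  have e : amp (W - s) (some true) H (W - 1) b - amp (W - s) (some false) H (W - 1) b =
      ∑ i ∈ Finset.range H.length, (if s - 1 ≤ i ∧ i < W then
        (if b = cnt H (i + 1) then (1 : ℝ) else 0) - (if b = cnt H i then 1 else 0) else 0) := by
    simp only [amp]
    rw [← Finset.sum_sub_distrib]
    refine Finset.sum_congr rfl fun i _ => ?_
    rw [cnt_succ]
    have e1 : (i ≤ W - 1 ∧ W - 1 ≤ W - s + i) ↔ (s - 1 ≤ i ∧ i < W) := by omega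
    by_cases hc : s - 1 ≤ i ∧ i < W
    · rw [if_pos hc]
      have hc' := e1.2 hc
      cases H.getD i false <;> simp [hc'.1, hc'.2]
    · rw [if_neg hc, if_neg (fun h => hc (e1.1 ⟨h.2.1, h.2.2.1⟩)),
        if_neg (fun h => hc (e1.1 ⟨h.2.1, h.2.2.1⟩)), sub_zero]
  rw [add_sub_assoc, e, sum_range_telescope (fun i => if b = cnt H i then (1 : ℝ) else 0)
    (show s - 1 ≤ W by omega)]
  simp only [amp]
  have e2 : W - 1 - (W - s) = s - 1 := by omega
  rw [e2]
  by_cases hd : s ≤ H.length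
  · rw [max_eq_right (by omega), cnt_min_length]
    have h1 : W - s ≤ W - 1 := by omega
    have h2 : W - 1 < W - s + H.length := by omega
    simp only [h1, h2, hd, true_and]
    ring
  · rw [max_eq_left (by omega), sub_self, add_zero, if_neg (fun hc => by omega),
      if_neg (fun hc => hd hc.1)]

/-- Signs with which the kinds of items are combined. -/
def kindSign : Bool × Option Bool → ℝ
  | (false, some false) => -1
  | (false, _) => 1
  | (true, some false) => 1
  | (true, _) => -1

/-- Birth position of the items of family `r`, for degrees in `[lo, W)`. -/
def birthPos (lo W : ℕ) (r : Bool) : ℕ := if r then 0 else W - lo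

/-- Families with `s = lo` and `s = W` are subtracted. For degrees from `W` on they cancel; below
`W`, `cnt H W` is the full count. -/
theorem sum_kindSign_amp {lo W : ℕ} (hlo : 1 ≤ lo) (hW : lo ≤ W) (H : List Bool) (b : ℕ) :
    ∑ k : Bool × Option Bool, kindSign k * amp (birthPos lo W k.1) k.2 H (W - 1) b =
      if (lo ≤ H.length ∧ H.length < W) ∧ b = H.count true then 1 else 0 := by
  have h0 := amp_slot hlo hW H b
  have h1 := amp_slot (hlo.trans hW) le_rfl H b
  rw [Nat.sub_self] at h1
  have e : ∑ k : Bool × Option Bool, kindSign k * amp (birthPos lo W k.1) k.2 H (W - 1) b =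
      (amp (W - lo) none H (W - 1) b + amp (W - lo) (some true) H (W - 1) b
        - amp (W - lo) (some false) H (W - 1) b) -
      (amp 0 none H (W - 1) b + amp 0 (some true) H (W - 1) b
        - amp 0 (some false) H (W - 1) b) := by
    simp only [Fintype.sum_prod_type, Fintype.sum_bool, Fintype.sum_option, kindSign, birthPos]
    norm_num
    ring
  rw [e, h0, h1]
  by_cases hd : W ≤ H.length
  · rw [if_neg (show ¬ ((lo ≤ H.length ∧ H.length < W) ∧ b = H.count true) by omega)]
    simp [hd, hW.trans hd]
  · rw [if_neg (show ¬ (W ≤ H.length ∧ b = cnt H W) by omega),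
      cnt_of_length_le (by omega : H.length ≤ W), sub_zero]
    simp [not_le.1 hd]

/-! ### The sketch

A vertex of degree `d` holds items that are carried through its positions by the edges at the
vertex; new items are taken from a uniform superposition of scratch labels. -/

/-- A stream element: an edge and two sampling bits. -/
abbrev HashedEdge (n : ℕ) : Type := (Fin n × Fin n) × Bool × Bool

namespace HashedEdge

variable {n : ℕ}

/-- The endpoint observed in copy `c` of the sketch. -/
def endpoint (e : Fin n × Fin n) (c : Bool) : Fin n := if c then e.1 else e.2

/-- The sampling bit used in copy `c` of the sketch. -/
def bit (t : HashedEdge n) (c : Bool) : Bool := if c then t.2.1 else t.2.2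

/-- Whether the edge is incident to a vertex. -/
def incident (t : HashedEdge n) (w : Fin n) : Bool := decide (t.1.1 = w ∨ t.1.2 = w)

/-- Whether the edge is a sampled out-edge of a vertex. -/
def flag (c : Bool) (t : HashedEdge n) (w : Fin n) : Bool := decide (t.1.1 = w) && bit t c

/-- The history of a vertex in a list of edges, most recent first. -/
def hist (c : Bool) (w : Fin n) (past : List (HashedEdge n)) : List Bool :=
  (past.filter (incident · w)).map (flag c · w)

theorem incident_endpoint (t : HashedEdge n) (c : Bool) : incident t (endpoint t.1 c) = true := by
  cases c <;> simp [incident, endpoint]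

theorem hist_cons_of_incident {c : Bool} {w : Fin n} {t : HashedEdge n} (past)
    (h : incident t w = true) : hist c w (t :: past) = flag c t w :: hist c w past := by
  simp [hist, h]

theorem hist_cons_of_not_incident {c : Bool} {w : Fin n} {t : HashedEdge n} (past)
    (h : ¬ incident t w = true) : hist c w (t :: past) = hist c w past := by
  simp [hist, h]

end HashedEdge

open HashedEdge

/-- Family and kind of an item. -/
abbrev Kind : Type := Bool × Option Bool

/-- Basis labels of the sketch: scratch labels, and items given by copy, kind, vertex, position and
count. -/
abbrev SketchLabel (n κ M : ℕ) : Type :=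
  (Fin M × Bool × Kind × Bool) ⊕ (Bool × Kind × Fin n × Fin (2 * n + 1) × Fin κ)

/-- A sign. -/
def sgn (σ : Bool) : ℝ := if σ then 1 else -1

/-- Degree ranges `[lo, W)` observed in the two copies of the sketch. -/
structure SketchParams (n : ℕ) where
  lo : Bool → ℕ
  W : Bool → ℕ
  one_le_lo : ∀ c, 1 ≤ lo c
  lo_le : ∀ c, lo c ≤ W c
  W_le : ∀ c, W c ≤ 2 * n + 1

namespace SketchParams

variable {n κ M : ℕ} (S : SketchParams n)

/-- Number of scratch blocks consumed by an edge. -/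
def cost (t : HashedEdge n) : ℕ := 1 + S.W true * (bit t true).toNat + S.W false * (bit t false).toNat

/-- The scratch block from which an item is created. -/
def birthIdx (τ : Option Bool) (q : ℕ) : ℕ := if τ = none then 0 else q + 1

/-- Birth position of the items of a kind. -/
def birth (c : Bool) (k : Kind) : ℕ := birthPos (S.lo c) (S.W c) k.1

/-- Births use scratch blocks below the cost, whereas the remaining scratch is shifted down from
blocks at or above it, so the two never compete for a label. -/
theorem birthIdx_lt_cost {c : Bool} {k : Kind} {t : HashedEdge n} {w : Fin n} {q b : ℕ}
    (h : IsBirth (S.birth c k) (flag c t w) k.2 q b) : birthIdx k.2 q < S.cost t := by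
  obtain ⟨r, _ | δ⟩ := k
  · simp [birthIdx, cost, add_assoc]
  · obtain ⟨hf, hq, -⟩ := h
    have hb : bit t c = true := by
      rw [flag, Bool.and_eq_true] at hf
      exact hf.2
    have h1 := S.one_le_lo c
    have h2 := S.lo_le c
    have hq' : q < S.W c := by
      simp only [birth, birthPos] at hq
      split_ifs at hq <;> omega
    have : S.W c ≤ S.W true * (bit t true).toNat + S.W false * (bit t false).toNat := by
      cases c <;> simp [hb]
    simp only [birthIdx, reduceCtorEq, if_false, cost]
    omega

open scoped Classical in
/-- The label whose amplitude is moved to a given label by an edge. -/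
noncomputable def source (t : HashedEdge n) : SketchLabel n κ M → Option (SketchLabel n κ M)
  | .inl (s, x) => if h : s + S.cost t < M then some (.inl (⟨s + S.cost t, h⟩, x)) else none
  | .inr (c, k, w, q, b) =>
    if incident t w = true then
      if IsBirth (S.birth c k) (flag c t w) k.2 q b then
        if h : birthIdx k.2 q < M then
          some (.inl (⟨birthIdx k.2 q, h⟩, c, k, decide (t.1.1 = w))) else none
      else if 1 ≤ (q : ℕ) ∧ (flag c t w).toNat ≤ b then
        some (.inr (c, k, w, ⟨q - 1, by omega⟩, ⟨b - (flag c t w).toNat, by omega⟩))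
      else none
    else some (.inr (c, k, w, q, b))

theorem source_inl_eq {t : HashedEdge n} {s : Fin M} {x} {y : SketchLabel n κ M}
    (h : S.source t (.inl (s, x)) = some y) :
    ∃ s' : Fin M, (s' : ℕ) = s + S.cost t ∧ y = .inl (s', x) := by
  simp only [source] at h
  split_ifs at h with h'
  exact ⟨_, rfl, (Option.some.inj h).symm⟩

theorem source_inr_eq {t : HashedEdge n} {c k w q b} {y : SketchLabel n κ M}
    (h : S.source t (.inr (c, k, w, q, b)) = some y) :
    (incident t w = false ∧ y = .inr (c, k, w, q, b)) ∨
    (incident t w = true ∧ IsBirth (S.birth c k) (flag c t w) k.2 q b ∧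
      ∃ s : Fin M, (s : ℕ) = birthIdx k.2 q ∧ y = .inl (s, c, k, decide (t.1.1 = w))) ∨
    (incident t w = true ∧ ∃ (q' : Fin (2 * n + 1)) (b' : Fin κ), (q : ℕ) = q' + 1 ∧ (b : ℕ) = b' + (flag c t w).toNat ∧
      y = .inr (c, k, w, q', b')) := by
  simp only [source] at h
  split_ifs at h with h1 h2 h3 h4
  · exact Or.inr (Or.inl ⟨h1, h2, _, rfl, (Option.some.inj h).symm⟩)
  · exact Or.inr (Or.inr ⟨h1, _, _, (Nat.sub_add_cancel h4.1).symm,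
      (Nat.sub_add_cancel h4.2).symm, (Option.some.inj h).symm⟩)
  · exact Or.inl ⟨by simpa using h1, (Option.some.inj h).symm⟩

/-- The last component of a scratch label tells head from tail, so both endpoints can give birth at
the same time; the block number encodes the birth position. -/
theorem birth_unique {t : HashedEdge n} {c : Bool} {k : Kind} {w w' : Fin n}
    {q q' b b' : ℕ} (hw : incident t w = true) (hw' : incident t w' = true)
    (h : IsBirth (S.birth c k) (flag c t w) k.2 q b)
    (h' : IsBirth (S.birth c k) (flag c t w') k.2 q' b')
    (hq : birthIdx k.2 q = birthIdx k.2 q')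
    (hs : decide (t.1.1 = w) = decide (t.1.1 = w')) : w = w' ∧ q = q' ∧ b = b' := by
  have h1 : w = w' := by
    simp only [incident, decide_eq_true_eq] at hw hw'
    rw [decide_eq_decide] at hs
    by_cases hu : t.1.1 = w
    · exact hu.symm.trans (hs.1 hu)
    · exact (hw.resolve_left hu).symm.trans (hw'.resolve_left (mt hs.2 hu))
  obtain ⟨r, _ | δ⟩ := k
  · exact ⟨h1, h.1.trans h'.1.symm, h.2.trans h'.2.symm⟩
  · exact ⟨h1, by simpa [birthIdx] using hq, h.2.2.trans h'.2.2.symm⟩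

/-- No amplitude is copied: this is what makes the move a contraction, although labels may be
dropped at the boundary. -/
theorem source_injective {t : HashedEdge n} {y y' x : SketchLabel n κ M}
    (h : S.source t y = some x) (h' : S.source t y' = some x) : y = y' := by
  rcases y with ⟨s, z⟩ | ⟨c, k, w, q, b⟩ <;> rcases y' with ⟨s', z'⟩ | ⟨c', k', w', q', b'⟩
  · obtain ⟨s₁, e₁, rfl⟩ := S.source_inl_eq h
    obtain ⟨s₂, e₂, e⟩ := S.source_inl_eq h'
    simp only [Sum.inl.injEq, Prod.mk.injEq] at e ⊢
    refine ⟨Fin.ext ?_, e.2⟩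
    have := congrArg Fin.val e.1
    omega
  · obtain ⟨s₁, e₁, rfl⟩ := S.source_inl_eq h
    rcases S.source_inr_eq h' with ⟨-, e⟩ | ⟨-, hb, s₂, e₂, e⟩ | ⟨-, _, _, -, -, e⟩
    · cases e
    · simp only [Sum.inl.injEq, Prod.mk.injEq] at e
      have := congrArg Fin.val e.1
      have := S.birthIdx_lt_cost hb
      omega
    · cases e
  · obtain ⟨s₁, e₁, rfl⟩ := S.source_inl_eq h'
    rcases S.source_inr_eq h with ⟨-, e⟩ | ⟨-, hb, s₂, e₂, e⟩ | ⟨-, _, _, -, -, e⟩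
    · cases e
    · simp only [Sum.inl.injEq, Prod.mk.injEq] at e
      have := congrArg Fin.val e.1
      have := S.birthIdx_lt_cost hb
      omega
    · cases e
  · rcases S.source_inr_eq h with ⟨i, e⟩ | ⟨i, hb, s, e₁, e⟩ | ⟨i, q₁, b₁, e₁, e₂, e⟩ <;>
    rcases S.source_inr_eq h' with ⟨i', e'⟩ | ⟨i', hb', s', e₁', e'⟩ | ⟨i', q₁', b₁', e₁', e₂', e'⟩
    all_goals
      rw [e] at e'
      simp only [Sum.inl.injEq, Sum.inr.injEq, Prod.mk.injEq, reduceCtorEq] at e'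
    · obtain ⟨rfl, rfl, rfl, rfl, rfl⟩ := e'
      rfl
    · obtain ⟨-, -, rfl, -⟩ := e'
      rw [i] at i'
      cases i'
    · obtain ⟨rfl, rfl, rfl, hw⟩ := e'
      obtain ⟨rfl, hq, hb⟩ := S.birth_unique i i' hb hb' (e₁.symm.trans e₁') hw
      rw [Fin.ext hq, Fin.ext hb]
    · obtain ⟨-, -, rfl, -⟩ := e'
      rw [i] at i'
      cases i'
    · obtain ⟨rfl, rfl, rfl, rfl, rfl⟩ := e'
      rw [Fin.ext (e₁.trans e₁'.symm), Fin.ext (e₂.trans e₂'.symm)]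

open scoped Classical in
/-- The partial permutation of the labels effected by an edge. -/
noncomputable def moveMatrix (t : HashedEdge n) :
    Matrix (SketchLabel n κ M) (SketchLabel n κ M) ℂ :=
  fun y x => if S.source t y = some x then 1 else 0

theorem moveMatrix_mulVec (t : HashedEdge n) (ψ : SketchLabel n κ M → ℂ) (y) :
    (S.moveMatrix t *ᵥ ψ) y = (S.source t y).elim 0 ψ := by
  simp only [moveMatrix, Matrix.mulVec, dotProduct, ite_mul, one_mul, zero_mul]
  rcases S.source t y with _ | x
  · simp
  · exact (Finset.sum_eq_single x (fun i _ hi => if_neg fun hc => hi (Option.some.inj hc).symm)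
      (by simp)).trans (if_pos rfl)

theorem sum_norm_moveMatrix_mulVec_le (t : HashedEdge n) (ψ : SketchLabel n κ M → ℂ) :
    ∑ y, ‖(S.moveMatrix t *ᵥ ψ) y‖ ^ 2 ≤ ∑ x, ‖ψ x‖ ^ 2 := by
  classical
  have h : ∀ y, ‖(S.moveMatrix t *ᵥ ψ) y‖ ^ 2 =
      ∑ x, if S.source t y = some x then ‖ψ x‖ ^ 2 else 0 := by
    intro y
    rw [moveMatrix_mulVec]
    rcases S.source t y with _ | x
    · simp
    · simp only [Option.some.injEq, Finset.sum_ite_eq, Finset.mem_univ, if_true, Option.elim_some]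
  simp only [h]
  rw [Finset.sum_comm]
  refine Finset.sum_le_sum fun x _ => ?_
  by_cases hx : ∃ y, S.source (κ := κ) (M := M) t y = some x
  · obtain ⟨y, hy⟩ := hx
    rw [Finset.sum_eq_single y]
    · simp [hy]
    · intro y' _ hne
      rw [if_neg fun hc => hne (S.source_injective hc hy)]
    · simp
  · rw [Finset.sum_eq_zero fun y _ => if_neg fun hc => hx ⟨y, hc⟩]
    positivity

/-- The position at which the items are observed. -/
def slot (c : Bool) : Fin (2 * n + 1) :=
  ⟨S.W c - 1, by have := S.W_le c; omega⟩

/-- The labels observed on arrival of an edge. -/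
def slotLabel (t : HashedEdge n) (c : Bool) (k : Kind) (b : Fin κ) : SketchLabel n κ M :=
  .inr (c, k, endpoint t.1 c, S.slot c, b)

/-- Being one of the labels observed on arrival of an edge. -/
def IsSlot (t : HashedEdge n) (y : SketchLabel n κ M) : Prop :=
  ∃ c k b, y = S.slotLabel t c k b

theorem sum_slot_add (t : HashedEdge n) (f : SketchLabel n κ M → ℝ) :
    (open scoped Classical in ∑ y, if S.IsSlot t y then 0 else f y) +
      ∑ z : Bool × Kind × Fin κ, f (S.slotLabel t z.1 z.2.1 z.2.2) = ∑ y, f y := by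
  classical
  have hinj : Function.Injective
      (fun z : Bool × Kind × Fin κ => S.slotLabel (M := M) t z.1 z.2.1 z.2.2) := by
    rintro ⟨c, k, b⟩ ⟨c', k', b'⟩ h
    simp only [slotLabel, Sum.inr.injEq, Prod.mk.injEq] at h
    rw [h.1, h.2.1, h.2.2.2.2]
  have h2 : ∑ z : Bool × Kind × Fin κ, f (S.slotLabel t z.1 z.2.1 z.2.2) =
      ∑ y, if S.IsSlot t y then f y else 0 := by
    rw [← Finset.sum_filter]
    refine Finset.sum_bij (fun z _ => S.slotLabel t z.1 z.2.1 z.2.2) ?_ ?_ ?_ ?_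
    · intro z _
      exact Finset.mem_filter.2 ⟨Finset.mem_univ _, _, _, _, rfl⟩
    · intro a _ b _ hab
      exact hinj hab
    · intro y hy
      obtain ⟨c, k, b, rfl⟩ := (Finset.mem_filter.1 hy).2
      exact ⟨(c, k, b), Finset.mem_univ _, rfl⟩
    · intro z _
      rfl
  rw [h2, ← Finset.sum_add_distrib]
  refine Finset.sum_congr rfl fun y _ => ?_
  split_ifs <;> simp

open scoped Classical in
/-- Evolution without detection. -/
noncomputable def runMatrix (t : HashedEdge n) :
    Matrix (SketchLabel n κ M) (SketchLabel n κ M) ℂ :=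
  fun y x => if S.IsSlot t y then 0 else S.moveMatrix t y x

open scoped Classical in
theorem runMatrix_mulVec (t : HashedEdge n) (ψ : SketchLabel n κ M → ℂ) (y) :
    (S.runMatrix t *ᵥ ψ) y = if S.IsSlot t y then 0 else (S.moveMatrix t *ᵥ ψ) y := by
  simp only [runMatrix, Matrix.mulVec, dotProduct]
  split_ifs <;> simp

/-- The signed sum of the amplitudes with count `b` observed in copy `c`. -/
noncomputable def slotSum (t : HashedEdge n) (c : Bool) (b : Fin κ) (φ : SketchLabel n κ M → ℂ) :
    ℂ := ∑ k, (kindSign k : ℂ) * φ (S.slotLabel t c k b)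

open scoped Classical in
/-- The observed superposition of items of both endpoints with given counts. -/
noncomputable def slotVec (t : HashedEdge n) (J : Fin κ × Fin κ × Bool) : SketchLabel n κ M → ℂ :=
  ((√(1 / (12 * κ)) : ℝ) : ℂ) • ((∑ k, (kindSign k : ℂ) • Pi.single (S.slotLabel t true k J.1) 1) +
    (sgn J.2.2 : ℂ) • ∑ k, (kindSign k : ℂ) • Pi.single (S.slotLabel t false k J.2.1) 1)

theorem slotVec_dotProduct (t : HashedEdge n) (J : Fin κ × Fin κ × Bool)
    (φ : SketchLabel n κ M → ℂ) :
    S.slotVec t J ⬝ᵥ φ = ((√(1 / (12 * κ)) : ℝ) : ℂ) *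
      (S.slotSum t true J.1 φ + (sgn J.2.2 : ℂ) * S.slotSum t false J.2.1 φ) := by
  simp only [slotVec, slotSum, smul_dotProduct, add_dotProduct, sum_dotProduct, single_dotProduct,
    smul_eq_mul, one_mul]

theorem norm_kindSign (k : Kind) : ‖(kindSign k : ℂ)‖ = 1 := by
  obtain ⟨_ | _, _ | _ | _⟩ := k <;> simp [kindSign]

theorem norm_slotSum_sq_le (t : HashedEdge n) (c : Bool) (b : Fin κ) (φ : SketchLabel n κ M → ℂ) :
    ‖S.slotSum t c b φ‖ ^ 2 ≤ 6 * ∑ k, ‖φ (S.slotLabel t c k b)‖ ^ 2 := by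
  have h1 : ‖S.slotSum t c b φ‖ ≤ ∑ k, ‖φ (S.slotLabel t c k b)‖ := by
    refine (norm_sum_le _ _).trans (Finset.sum_le_sum fun k _ => ?_)
    rw [norm_mul, norm_kindSign, one_mul]
  calc ‖S.slotSum t c b φ‖ ^ 2 ≤ (∑ k, ‖φ (S.slotLabel t c k b)‖) ^ 2 := by gcongr
    _ ≤ (Finset.univ : Finset Kind).card * ∑ k, ‖φ (S.slotLabel t c k b)‖ ^ 2 :=
        sq_sum_le_card_mul_sum_sq
    _ = _ := by rw [show (Finset.univ : Finset Kind).card = 6 from rfl]; norm_num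

theorem norm_add_sgn_sum (x y : ℂ) :
    ∑ σ, ‖x + (sgn σ : ℂ) * y‖ ^ 2 = 2 * (‖x‖ ^ 2 + ‖y‖ ^ 2) := by
  rw [Fintype.sum_bool]
  simp only [sgn, if_true, Bool.false_eq_true, if_false, Complex.ofReal_one, one_mul,
    Complex.ofReal_neg, neg_mul, ← sub_eq_add_neg]
  have := parallelogram_law_with_norm ℝ x y
  simp only [sq]
  linarith

/-- The normalization `12 κ` is `2 * κ * 6`: the parallelogram law over the two signs gives 2, each
count at one endpoint is paired with `κ` guesses at the other, and Cauchy–Schwarz over the six kinds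
gives 6. -/
theorem sum_norm_slotVec_le (hκ : 1 ≤ κ) (t : HashedEdge n) (φ : SketchLabel n κ M → ℂ) :
    ∑ J : Fin κ × Fin κ × Bool, ‖S.slotVec t J ⬝ᵥ φ‖ ^ 2 ≤
      ∑ z : Bool × Kind × Fin κ, ‖φ (S.slotLabel t z.1 z.2.1 z.2.2)‖ ^ 2 := by
  have hκ' : (0 : ℝ) < κ := by exact_mod_cast hκ
  have e1 : ∑ J : Fin κ × Fin κ × Bool, ‖S.slotVec t J ⬝ᵥ φ‖ ^ 2 =
      1 / 6 * (∑ b, ‖S.slotSum t true b φ‖ ^ 2 + ∑ b, ‖S.slotSum t false b φ‖ ^ 2) := by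
    simp only [slotVec_dotProduct, norm_mul, mul_pow, Complex.norm_real, Real.norm_eq_abs, sq_abs]
    rw [Real.sq_sqrt (by positivity), ← Finset.mul_sum]
    simp only [Fintype.sum_prod_type, norm_add_sgn_sum, ← Finset.mul_sum, Finset.sum_add_distrib,
      Finset.sum_const, Finset.card_univ, Fintype.card_fin, nsmul_eq_mul]
    field_simp
    ring
  rw [e1, Fintype.sum_prod_type, Fintype.sum_bool]
  simp only [Fintype.sum_prod_type_right (γ := ℝ) (α₁ := Kind)]
  have h1 := Finset.sum_le_sum fun b (_ : b ∈ Finset.univ) => S.norm_slotSum_sq_le t true b φ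
  have h2 := Finset.sum_le_sum fun b (_ : b ∈ Finset.univ) => S.norm_slotSum_sq_le t false b φ
  rw [← Finset.mul_sum] at h1 h2
  linarith

end SketchParams

/-- Result of a detection: the edge, the guessed counts with a sign, and, for both endpoints, the
numbers of edges and of out-edges that have arrived afterwards. -/
abbrev Record (n κ : ℕ) : Type :=
  (Fin n × Fin n) × (Fin κ × Fin κ × Bool) × (Bool → ZMod (2 * n + 1) × ZMod (2 * n + 1))

/-! ### Records and the later degrees kept in them -/

theorem sum_record {n κ : ℕ} (e : Fin n × Fin n) (F : Record n κ → ℝ) :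
    ∑ d : Record n κ, (if d.1 = e ∧ d.2.2 = 0 then F d else 0) = ∑ J, F (e, J, 0) := by
  rw [← Finset.sum_filter]
  refine (Finset.sum_bij (fun J _ => (e, J, 0)) ?_ ?_ ?_ ?_).symm
  · intro J _
    simp
  · intro J _ J' _ h
    simpa using h
  · rintro ⟨e', J, z⟩ hd
    obtain ⟨rfl, rfl⟩ := (Finset.mem_filter.1 hd).2
    exact ⟨J, Finset.mem_univ _, rfl⟩
  · intro J _
    rfl

/-- Counting the later edges at the endpoints of the detected edge. -/
def Record.update {n κ : ℕ} (d : Record n κ) (t : HashedEdge n) : Record n κ :=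
  (d.1, d.2.1, fun c => d.2.2 c +
    (if incident t (endpoint d.1 c) = true then 1 else 0,
      if decide (t.1.1 = endpoint d.1 c) = true then 1 else 0))

theorem Record.foldl_update {n κ : ℕ} (l : List (HashedEdge n)) (d : Record n κ) :
    l.foldl Record.update d = (d.1, d.2.1, fun c => d.2.2 c +
      (((l.countP (incident · (endpoint d.1 c)) : ℕ) : ZMod (2 * n + 1)),
        ((l.countP (fun t => decide (t.1.1 = endpoint d.1 c)) : ℕ) : ZMod (2 * n + 1)))) := by
  induction l generalizing d with
  | nil => exact Prod.ext rfl (Prod.ext rfl (funext fun c => Prod.ext (by simp) (by simp)))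
  | cons t l ih =>
    rw [List.foldl_cons, ih]
    simp only [Record.update, List.countP_cons]
    refine Prod.ext rfl (Prod.ext rfl (funext fun c => Prod.ext ?_ ?_))
    · simp only [Prod.fst_add, Nat.cast_add, Nat.cast_ite, Nat.cast_one, Nat.cast_zero]
      rw [add_assoc, add_comm (ite _ _ _)]
    · simp only [Prod.snd_add, Nat.cast_add, Nat.cast_ite, Nat.cast_one, Nat.cast_zero]
      rw [add_assoc, add_comm (ite _ _ _)]
      rfl

/-! ### The state of the sketch along the stream -/

namespace SketchParams

variable {n κ M : ℕ} (S : SketchParams n)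

open scoped Classical in
/-- The amplitude of the detection of an edge with given guesses. -/
noncomputable def detectVec (t : HashedEdge n) (d : Record n κ) : SketchLabel n κ M → ℂ :=
  if d.1 = t.1 ∧ d.2.2 = 0 then S.slotVec t d.2.1 ᵥ* S.moveMatrix t else 0

/-- Initial amplitude of a scratch label. -/
noncomputable def unit (M : ℕ) : ℝ := 1 / √(24 * M)

theorem unit_sq (M : ℕ) : unit M ^ 2 = 1 / (24 * M) := by
  rw [unit, div_pow, one_pow, Real.sq_sqrt (by positivity)]

theorem sum_norm_detectVec (t : HashedEdge n) (ψ : SketchLabel n κ M → ℂ) (X : Record n κ → ℝ) :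
    ∑ d : Record n κ, ‖S.detectVec t d ⬝ᵥ ψ‖ ^ 2 * X d =
      ∑ J, ‖S.slotVec t J ⬝ᵥ (S.moveMatrix t *ᵥ ψ)‖ ^ 2 * X (t.1, J, 0) := by
  rw [← sum_record t.1 (fun d => ‖S.slotVec t d.2.1 ⬝ᵥ (S.moveMatrix t *ᵥ ψ)‖ ^ 2 * X d)]
  refine Finset.sum_congr rfl fun d _ => ?_
  unfold detectVec
  split_ifs
  · rw [Matrix.dotProduct_mulVec]
  · simp

/-- The detection process on the sketch. -/
noncomputable def detector (hκ : 1 ≤ κ) (hM : 1 ≤ M) :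
    Detector (HashedEdge n) (SketchLabel n κ M) (Record n κ) where
  run := S.runMatrix
  detect := S.detectVec
  contraction t x := by
    have h := S.sum_norm_detectVec t x (fun _ => 1)
    simp only [mul_one] at h
    rw [h]
    refine le_trans ?_ (S.sum_norm_moveMatrix_mulVec_le t x)
    rw [← S.sum_slot_add t (fun y => ‖(S.moveMatrix t *ᵥ x) y‖ ^ 2)]
    refine add_le_add (le_of_eq ?_) (S.sum_norm_slotVec_le hκ t _)
    refine Finset.sum_congr rfl fun y _ => ?_
    rw [runMatrix_mulVec]
    split_ifs <;> simp
  update := Record.update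
  start := Sum.elim (fun _ => (unit M : ℂ)) 0
  start_norm := by
    rw [Fintype.sum_sum_type]
    have hM' : (0 : ℝ) < M := by exact_mod_cast hM
    have hc : Fintype.card (Fin M × Bool × Kind × Bool) = M * 24 := by
      simp only [Fintype.card_prod, Fintype.card_fin]
      rfl
    simp only [Sum.elim_inl, Sum.elim_inr, Pi.zero_apply, norm_zero, Finset.sum_const,
      Finset.card_univ, hc, nsmul_eq_mul, Complex.norm_real, Real.norm_eq_abs, sq_abs, unit_sq]
    push_cast
    field_simp
    norm_num

/-- The state after the edges `past` (most recent first), with `R` scratch blocks left. -/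
structure Inv (R : ℕ) (past : List (HashedEdge n)) (ψ : SketchLabel n κ M → ℂ) : Prop where
  scratch : ∀ (s : Fin M) x, (s : ℕ) < R → ψ (.inl (s, x)) = unit M
  item : ∀ (c : Bool) (k : Kind) (w : Fin n) (q : Fin (2 * n + 1)) (b : Fin κ),
    (q : ℕ) + 1 < S.W c →
      ψ (.inr (c, k, w, q, b)) = unit M * amp (S.birth c k) k.2 (hist c w past) q b

theorem inv_start (hκ : 1 ≤ κ) (hM : 1 ≤ M) : S.Inv M [] (S.detector hκ hM).start where
  scratch _ _ _ := rfl
  item c k w q b _ := by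
    simp [detector, hist, amp_nil]

variable {S}

theorem Inv.move_scratch {R : ℕ} {past : List (HashedEdge n)} {ψ : SketchLabel n κ M → ℂ}
    (h : S.Inv R past ψ) (hR : R ≤ M) (t : HashedEdge n) (s : Fin M) (x)
    (hs : (s : ℕ) + S.cost t < R) : (S.moveMatrix t *ᵥ ψ) (.inl (s, x)) = unit M := by
  rw [moveMatrix_mulVec, source, dif_pos (hs.trans_le hR)]
  exact h.scratch _ _ hs

/-- The invariant says nothing about position `W c - 1`. There the new amplitude is known only at
endpoints of the edge, where it arrives from one position below or from scratch. -/
theorem Inv.move_item {R : ℕ} {past : List (HashedEdge n)} {ψ : SketchLabel n κ M → ℂ}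
    (h : S.Inv R past ψ) (hR : R ≤ M) (t : HashedEdge n) (ht : S.cost t ≤ R)
    (c : Bool) (k : Kind) (w : Fin n) (q : Fin (2 * n + 1)) (b : Fin κ)
    (hq : (q : ℕ) + 1 ≤ S.W c) (hw : incident t w = true ∨ (q : ℕ) + 1 < S.W c) :
    (S.moveMatrix t *ᵥ ψ) (.inr (c, k, w, q, b)) =
      unit M * amp (S.birth c k) k.2 (hist c w (t :: past)) q b := by
  rw [moveMatrix_mulVec, source]
  by_cases hi : incident t w = true
  · rw [if_pos hi, hist_cons_of_incident past hi, amp_cons]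
    split_ifs with h1 h2 h3
    · rw [Option.elim_some, h.scratch _ _ ((S.birthIdx_lt_cost h1).trans_le ht)]
      simp
    · exact absurd (((S.birthIdx_lt_cost h1).trans_le ht).trans_le hR) h2
    · rw [Option.elim_some, h.item]
      simp only
      omega
    · simp
  · rw [if_neg hi, hist_cons_of_not_incident past hi, Option.elim_some,
      h.item _ _ _ _ _ (hw.resolve_left hi)]

/-- Erasing the observed labels is harmless: amplitudes only move upward, and the invariant concerns
positions strictly below the slot. -/
theorem Inv.run {R : ℕ} {past : List (HashedEdge n)} {ψ : SketchLabel n κ M → ℂ}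
    (h : S.Inv R past ψ) (hR : R ≤ M) (t : HashedEdge n) (ht : S.cost t ≤ R) :
    S.Inv (R - S.cost t) (t :: past) (S.runMatrix t *ᵥ ψ) where
  scratch s x hs := by
    rw [runMatrix_mulVec, if_neg, h.move_scratch hR t s x (by omega)]
    rintro ⟨c, k, b, e⟩
    cases e
  item c k w q b hq := by
    rw [runMatrix_mulVec, if_neg, h.move_item hR t ht c k w q b hq.le (Or.inr hq)]
    rintro ⟨c', k', b', e⟩
    simp only [slotLabel, Sum.inr.injEq, Prod.mk.injEq] at e
    obtain ⟨rfl, -, -, rfl, -⟩ := e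
    simp only [slot] at hq
    omega

variable (S) in
/-- Whether the endpoint of the last edge has its degree in the observed range and count `b`. -/
def hit (past : List (HashedEdge n)) (c : Bool) (w : Fin n) (b : ℕ) : ℝ :=
  if (S.lo c ≤ (hist c w past).length ∧ (hist c w past).length < S.W c) ∧
    b = (hist c w past).count true then 1 else 0

theorem Inv.slotSum {R : ℕ} {past : List (HashedEdge n)} {ψ : SketchLabel n κ M → ℂ}
    (h : S.Inv R past ψ) (hR : R ≤ M) (t : HashedEdge n) (ht : S.cost t ≤ R) (c : Bool)
    (b : Fin κ) : S.slotSum t c b (S.moveMatrix t *ᵥ ψ) =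
      ((unit M * S.hit (t :: past) c (endpoint t.1 c) b : ℝ) : ℂ) := by
  have hW := (S.one_le_lo c).trans (S.lo_le c)
  have e : ∀ k, (S.moveMatrix t *ᵥ ψ) (S.slotLabel t c k b) =
      unit M * amp (S.birth c k) k.2 (hist c (endpoint t.1 c) (t :: past)) (S.W c - 1) b :=
    fun k => h.move_item hR t ht c k _ _ b (by simp only [slot]; omega)
      (Or.inl (incident_endpoint t c))
  simp only [SketchParams.slotSum, e]
  rw [hit, ← sum_kindSign_amp (S.one_le_lo c) (S.lo_le c), Finset.mul_sum]
  push_cast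
  refine Finset.sum_congr rfl fun k _ => ?_
  rw [birth]
  ring

variable (S) in
/-- The contribution of the detection of one edge to the expectation of a function of the
record. -/
noncomputable def stepMean (M : ℕ) (X : Record n κ → ℝ) (past : List (HashedEdge n))
    (t : HashedEdge n) (l : List (HashedEdge n)) : ℝ :=
  ∑ J : Fin κ × Fin κ × Bool, 1 / (288 * κ * M) *
    (S.hit (t :: past) true t.1.1 J.1 + sgn J.2.2 * S.hit (t :: past) false t.1.2 J.2.1) ^ 2 *
    X (l.foldl Record.update (t.1, J, 0))

/-- The denominator `288 κ M` is `12 κ` from `slotVec` times `24 M` from `unit`. -/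
theorem Inv.sum_detect {R : ℕ} {past : List (HashedEdge n)} {ψ : SketchLabel n κ M → ℂ}
    (h : S.Inv R past ψ) (hR : R ≤ M) (t : HashedEdge n) (ht : S.cost t ≤ R)
    (X : Record n κ → ℝ) (l : List (HashedEdge n)) :
    ∑ d : Record n κ, ‖S.detectVec t d ⬝ᵥ ψ‖ ^ 2 * X (l.foldl Record.update d) =
      S.stepMean M X past t l := by
  rw [S.sum_norm_detectVec t ψ (fun d => X (l.foldl Record.update d)), stepMean]
  refine Finset.sum_congr rfl fun J _ => ?_
  rw [slotVec_dotProduct, h.slotSum hR t ht, h.slotSum hR t ht]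
  congr 1
  rw [← Complex.ofReal_mul, ← Complex.ofReal_add, ← Complex.ofReal_mul, Complex.norm_real,
    Real.norm_eq_abs, sq_abs, mul_pow, Real.sq_sqrt (by positivity)]
  have e : unit M * S.hit (t :: past) true (endpoint t.1 true) J.1 +
      sgn J.2.2 * (unit M * S.hit (t :: past) false (endpoint t.1 false) J.2.1) =
      unit M * (S.hit (t :: past) true t.1.1 J.1 + sgn J.2.2 * S.hit (t :: past) false t.1.2 J.2.1)
      := by
    simp only [endpoint, if_true, Bool.false_eq_true, if_false]
    ring
  have e' : (12 * κ * (24 * M) : ℝ) = 288 * κ * M := by ring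
  rw [e, mul_pow, unit_sq, ← mul_assoc, div_mul_div_comm, one_mul, e']

variable (S) in
/-- The expectation of a function of the record over the remaining edges. -/
noncomputable def meanFrom (M : ℕ) (X : Record n κ → ℝ) :
    List (HashedEdge n) → List (HashedEdge n) → ℝ
  | _, [] => 0
  | past, t :: l => S.stepMean M X past t l + meanFrom M X (t :: past) l

/-- The budget `hl` guarantees that every birth finds scratch of full amplitude. -/
theorem Inv.detectSum (hκ : 1 ≤ κ) (hM : 1 ≤ M) (X : Record n κ → ℝ) (l : List (HashedEdge n))
    {R : ℕ} {past : List (HashedEdge n)} {ψ : SketchLabel n κ M → ℂ}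
    (h : S.Inv R past ψ) (hR : R ≤ M) (hl : (l.map S.cost).sum ≤ R) :
    (S.detector hκ hM).detectSum X ψ l = S.meanFrom M X past l := by
  induction l generalizing R past ψ with
  | nil => rfl
  | cons t l ih =>
    rw [List.map_cons, List.sum_cons] at hl
    have ht : S.cost t ≤ R := by omega
    rw [Detector.detectSum, meanFrom]
    congr 1
    · exact h.sum_detect hR t ht X l
    · exact ih (h.run hR t ht) (by omega) (by omega)

theorem meanFrom_eq_sum (X : Record n κ → ℝ) (l past : List (HashedEdge n)) :
    S.meanFrom M X past l = ∑ k : Fin l.length,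
      S.stepMean M X ((l.take k).reverse ++ past) l[k] (l.drop (k + 1)) := by
  induction l generalizing past with
  | nil => rfl
  | cons t l ih =>
    rw [meanFrom, ih]
    refine Eq.trans ?_ (Fin.sum_univ_succ _).symm
    congr 1
    refine Finset.sum_congr rfl fun k _ => ?_
    simp

/-- The streaming algorithm of the sketch. -/
theorem exists_alg (S : SketchParams n) (hκ : 1 ≤ κ) (hM : 1 ≤ M) :
    ∃ (A : QuantumStreamAlg (HashedEdge n)) (dec : A.Mem → Option (Record n κ)),
      A.space = Nat.clog 2 (Fintype.card (SketchLabel n κ M)) +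
        Nat.clog 2 (Fintype.card (Record n κ) + 2) ∧
      ∀ (X : Record n κ → ℝ) (l : List (HashedEdge n)), (l.map S.cost).sum ≤ M →
        A.mean l (fun o => (dec o).elim 0 X) = ∑ k : Fin l.length,
          S.stepMean M X (l.take k).reverse l[k] (l.drop (k + 1)) := by
  obtain ⟨A, dec, hA, h⟩ := (S.detector hκ hM).exists_alg
  refine ⟨A, dec, hA, fun X l hl => ?_⟩
  rw [h, (S.inv_start hκ hM).detectSum hκ hM X l le_rfl hl, meanFrom_eq_sum]
  simp

end SketchParams

/-! ### Degree classes -/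

section Thresholds

variable {ε : ℝ} {n : ℕ}

theorem pow_lastLevel_le (hε : 0 < ε) (hn : 2 ≤ n) : (1 + ε ^ 3) ^ lastLevel ε n ≤ (n : ℝ) := by
  have hx : 1 < 1 + ε ^ 3 := by linarith [pow_pos hε 3]
  have hn' : (2 : ℝ) ≤ n := by exact_mod_cast hn
  have h := Nat.floor_le (Real.logb_nonneg hx (by linarith : (1 : ℝ) ≤ n))
  rw [Real.le_logb_iff_rpow_le hx (by linarith), Real.rpow_natCast] at h
  exact h

theorem lt_pow_lastLevel_succ (hε : 0 < ε) (hn : 2 ≤ n) :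
    (n : ℝ) < (1 + ε ^ 3) ^ (lastLevel ε n + 1) := by
  have hx : 1 < 1 + ε ^ 3 := by linarith [pow_pos hε 3]
  have hn' : (2 : ℝ) ≤ n := by exact_mod_cast hn
  have h := Nat.lt_floor_add_one (Real.logb (1 + ε ^ 3) n)
  rw [Real.logb_lt_iff_lt_rpow hx (by linarith)] at h
  exact_mod_cast h

theorem one_le_degThreshold (hε : 0 < ε) (hn : 2 ≤ n) (i : ℕ) : 1 ≤ degThreshold ε n i := by
  unfold degThreshold
  split_ifs
  · rw [Nat.one_le_floor_iff]
    exact one_le_pow₀ (by linarith [pow_pos hε 3])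
  · omega

theorem degThreshold_le (hε : 0 < ε) (hn : 2 ≤ n) (i : ℕ) : degThreshold ε n i ≤ n := by
  unfold degThreshold
  split_ifs with h
  · refine Nat.floor_le_of_le (le_trans ?_ (pow_lastLevel_le hε hn))
    exact pow_le_pow_right₀ (by linarith [pow_pos hε 3]) h.le
  · exact le_rfl

theorem degThreshold_mono (hε : 0 < ε) (hn : 2 ≤ n) {i j : ℕ} (hij : i ≤ j) :
    degThreshold ε n i ≤ degThreshold ε n j := by
  by_cases hj : j < lastLevel ε n
  · rw [degThreshold, degThreshold, if_pos hj, if_pos (hij.trans_lt hj)]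
    exact Nat.floor_le_floor (pow_le_pow_right₀ (by linarith [pow_pos hε 3]) hij)
  · conv_rhs => rw [degThreshold, if_neg hj]
    exact degThreshold_le hε hn i

/-- End of a degree class, for degrees up to `2 n`. -/
noncomputable def classEnd (ε : ℝ) (n i : ℕ) : ℕ :=
  if i < lastLevel ε n then degThreshold ε n (i + 1) else 2 * n + 1

theorem degThreshold_le_classEnd (hε : 0 < ε) (hn : 2 ≤ n) (i : ℕ) :
    degThreshold ε n i ≤ classEnd ε n i := by
  unfold classEnd
  split_ifs
  · exact degThreshold_mono hε hn (Nat.le_succ i)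
  · have := degThreshold_le hε hn i
    omega

theorem classEnd_le (hε : 0 < ε) (hn : 2 ≤ n) (i : ℕ) : classEnd ε n i ≤ 2 * n + 1 := by
  unfold classEnd
  split_ifs
  · have := degThreshold_le hε hn (i + 1)
    omega
  · exact le_rfl

/-- A sampled edge consumes about `W` scratch blocks, while the hypothesis on the hash functions
charges `d_i`; the two are comparable because `1 + ε ^ 3 ≤ 2`. -/
theorem classEnd_le_mul (hε : 0 < ε) (hε1 : ε ≤ 1) (hn : 2 ≤ n) (i : ℕ) :
    classEnd ε n i ≤ 7 * degThreshold ε n i := by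
  have h1 := one_le_degThreshold hε hn i
  unfold classEnd
  split_ifs with hi
  · set x : ℝ := 1 + ε ^ 3 with hx
    have hx1 : 1 ≤ x := by linarith [pow_pos hε 3]
    have hx2 : x ≤ 2 := by linarith [pow_le_one₀ (n := 3) hε.le hε1]
    have hlo : x ^ i < degThreshold ε n i + 1 := by
      rw [degThreshold, if_pos hi]
      exact Nat.lt_floor_add_one _
    have hp : 0 < x ^ i := by positivity
    -- The exponent is `i + 2` because the last threshold is `n`, which may exceed the power of its
    -- own index but not the next one.
    have hle : (degThreshold ε n (i + 1) : ℝ) ≤ x ^ (i + 2) := by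
      unfold degThreshold
      split_ifs with hi'
      · exact (Nat.floor_le (by positivity)).trans (pow_le_pow_right₀ hx1 (by omega))
      · have h := lt_pow_lastLevel_succ hε hn
        rw [show lastLevel ε n + 1 = i + 2 by omega] at h
        exact h.le
    have h4 : x ^ (i + 2) ≤ 4 * x ^ i := by
      rw [pow_add, mul_comm]
      gcongr
      nlinarith
    -- Strictness gives at most `4 D + 3` with `D` the lower threshold, hence at most `7 D` as `D ≥
    -- 1`.
    have h5 : (degThreshold ε n (i + 1) : ℝ) < ((4 * degThreshold ε n i + 4 : ℕ) : ℝ) := by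
      push_cast
      linarith
    have := Nat.cast_lt.1 h5
    omega
  · rw [degThreshold, if_neg hi]
    omega

/-- Degrees never exceed `2 n`, so the unbounded last class may be cut off at `2 n + 1`. -/
theorem inDegreeClass_iff {i d : ℕ} (hd : d ≤ 2 * n) :
    InDegreeClass ε n i d ↔ degThreshold ε n i ≤ d ∧ d < classEnd ε n i := by
  unfold InDegreeClass classEnd
  refine and_congr_right fun _ => ?_
  split_ifs with h
  · simp [h]
  · exact ⟨fun _ => by omega, fun _ h' => absurd h' h⟩

theorem degLevel_eq (hε : 0 < ε) (hn : 2 ≤ n) {i d : ℕ} (hi : i ≤ lastLevel ε n)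
    (h : InDegreeClass ε n i d) : degLevel ε n d = i := by
  rw [degLevel, Nat.findGreatest_eq_iff]
  refine ⟨hi, fun _ => h.1, fun j hij hj hd => ?_⟩
  have h1 := h.2 (hij.trans_le hj)
  have h2 := degThreshold_mono hε hn (show i + 1 ≤ j from hij)
  omega

end Thresholds

/-! ### Counting in the stream -/

theorem countP_take_ofFn {T : Type*} (p : T → Bool) {m : ℕ} (g : Fin m → T) (i : ℕ) :
    ((List.ofFn g).take i).countP p =
      (Finset.univ.filter fun j : Fin m => (j : ℕ) < i ∧ p (g j) = true).card := by
  rw [Finset.card_filter]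
  induction m generalizing i with
  | zero => simp
  | succ m ih =>
    cases i with
    | zero => simp
    | succ i =>
      rw [List.ofFn_succ, List.take_succ_cons, List.countP_cons, ih, Fin.sum_univ_succ, add_comm]
      simp

theorem countP_drop_ofFn {T : Type*} (p : T → Bool) {m : ℕ} (g : Fin m → T) (i : ℕ) :
    ((List.ofFn g).drop i).countP p =
      (Finset.univ.filter fun j : Fin m => i ≤ (j : ℕ) ∧ p (g j) = true).card := by
  rw [Finset.card_filter]
  induction m generalizing i with
  | zero => simp
  | succ m ih =>
    cases i with
    | zero =>
      have := ih (fun j => g j.succ) 0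
      rw [List.drop_zero] at this
      rw [List.ofFn_succ, List.drop_zero, List.countP_cons, this, Fin.sum_univ_succ, add_comm]
      simp
    | succ i =>
      rw [List.ofFn_succ, List.drop_succ_cons, ih, Fin.sum_univ_succ]
      simp

theorem sum_length_ofFn {T : Type*} {m : ℕ} (g : Fin m → T) (F : ℕ → T → ℝ) :
    ∑ k : Fin (List.ofFn g).length, F k (List.ofFn g)[k] = ∑ k : Fin m, F k (g k) := by
  refine Fintype.sum_equiv (finCongr List.length_ofFn) _ _ fun k => ?_
  simp only [List.getElem_ofFn, Fin.getElem_fin]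
  rfl

namespace HashedEdge

theorem incident_iff {n : ℕ} {t : HashedEdge n} {w : Fin n} :
    incident t w = true ↔ t.1.1 = w ∨ t.1.2 = w := decide_eq_true_iff

theorem flag_iff {n : ℕ} {c : Bool} {t : HashedEdge n} {w : Fin n} :
    flag c t w = true ↔ t.1.1 = w ∧ bit t c = true := by
  rw [flag, Bool.and_eq_true, decide_eq_true_iff]

end HashedEdge

namespace EdgeStream

variable {n m : ℕ} (G : EdgeStream n m)

/-- The element of the hashed stream at a given time. -/
def token (f : ℕ → Fin n × Fin n → Bool) (α β : ℕ) (k : Fin m) : HashedEdge n :=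
  (G.edge k, f α (G.edge k), f β (G.edge k))

/-- The number of sampled out-edges of a vertex up to a given time. -/
def sampled (f : ℕ → Fin n × Fin n → Bool) (i : ℕ) (k : Fin m) (v : Fin n) : ℕ :=
  (Finset.univ.filter fun j => j ≤ k ∧ (G.edge j).1 = v ∧ f i (G.edge j) = true).card

/-- The edges up to a given time, most recent first. -/
def upTo (f : ℕ → Fin n × Fin n → Bool) (α β : ℕ) (k : Fin m) : List (HashedEdge n) :=
  ((List.ofFn (G.token f α β)).take (k + 1)).reverse

theorem cons_take_reverse (f : ℕ → Fin n × Fin n → Bool) (α β : ℕ) (k : Fin m) :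
    G.token f α β k :: ((List.ofFn (G.token f α β)).take k).reverse = G.upTo f α β k := by
  rw [upTo, List.take_succ_eq_append_getElem (by simp), List.reverse_append]
  simp

theorem length_hist (f : ℕ → Fin n × Fin n → Bool) (α β : ℕ) (k : Fin m) (c : Bool) (w : Fin n) :
    (hist c w (G.upTo f α β k)).length = G.degUpTo k w := by
  rw [hist, List.length_map, upTo, List.filter_reverse, List.length_reverse,
    ← List.countP_eq_length_filter, countP_take_ofFn, degUpTo]
  congr 1
  ext j
  simp only [incident_iff]
  simp [token]

theorem count_hist (f : ℕ → Fin n × Fin n → Bool) (α β : ℕ) (k : Fin m) (c : Bool) (w : Fin n) :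
    (hist c w (G.upTo f α β k)).count true = G.sampled f (if c then α else β) k w := by
  rw [hist, upTo, List.filter_reverse, List.map_reverse, List.count_reverse, List.count,
    List.countP_map, List.countP_filter, countP_take_ofFn, sampled]
  congr 1
  ext j
  simp only [Function.comp, Bool.and_eq_true, beq_iff_eq, incident_iff, flag_iff]
  cases c <;> simp only [Finset.mem_filter, Finset.mem_univ, true_and, Nat.lt_succ_iff, token, bit,
    Bool.false_eq_true, if_false, if_true, Fin.le_def] <;> tauto

theorem countP_incident (f : ℕ → Fin n × Fin n → Bool) (α β : ℕ) (k : Fin m) (w : Fin n) :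
    ((List.ofFn (G.token f α β)).drop (k + 1)).countP (incident · w) = G.degAfter k w := by
  rw [countP_drop_ofFn, degAfter]
  congr 1
  ext j
  simp only [incident_iff]
  simp [token]

theorem countP_head (f : ℕ → Fin n × Fin n → Bool) (α β : ℕ) (k : Fin m) (w : Fin n) :
    ((List.ofFn (G.token f α β)).drop (k + 1)).countP (fun t => decide (t.1.1 = w)) =
      G.outDegAfter k w := by
  rw [countP_drop_ofFn, outDegAfter]
  congr 1
  ext j
  simp only [decide_eq_true_eq]
  simp [token]

/-- Simplicity allows at most `n` edges with a given head and `n` with a given tail; antiparallel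
pairs are why the bound is not `n`. -/
theorem card_incident_le (v : Fin n) :
    (Finset.univ.filter fun j => (G.edge j).1 = v ∨ (G.edge j).2 = v).card ≤ 2 * n := by
  have h1 : (Finset.univ.filter fun j => (G.edge j).1 = v).card ≤ n := by
    have := Finset.card_le_card_of_injOn (s := Finset.univ.filter fun j => (G.edge j).1 = v)
      (t := (Finset.univ : Finset (Fin n))) (fun j => (G.edge j).2) (fun _ _ => Finset.mem_univ _)
      (fun i hi j hj h => G.injective (Prod.ext
        ((by simpa using hi : (G.edge i).1 = v).trans (by simpa using hj : (G.edge j).1 = v).symm)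
        h))
    simpa using this
  have h2 : (Finset.univ.filter fun j => (G.edge j).2 = v).card ≤ n := by
    have := Finset.card_le_card_of_injOn (s := Finset.univ.filter fun j => (G.edge j).2 = v)
      (t := (Finset.univ : Finset (Fin n))) (fun j => (G.edge j).1) (fun _ _ => Finset.mem_univ _)
      (fun i hi j hj h => G.injective (Prod.ext h
        ((by simpa using hi : (G.edge i).2 = v).trans (by simpa using hj : (G.edge j).2 = v).symm)))
    simpa using this
  rw [Finset.filter_or]
  exact (Finset.card_union_le _ _).trans (by omega)

theorem degUpTo_le (k : Fin m) (v : Fin n) : G.degUpTo k v ≤ 2 * n :=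
  (Finset.card_le_card fun j hj => by simp at hj ⊢; exact hj.2).trans (G.card_incident_le v)

theorem degAfter_le (k : Fin m) (v : Fin n) : G.degAfter k v ≤ 2 * n :=
  (Finset.card_le_card fun j hj => by simp at hj ⊢; exact hj.2).trans (G.card_incident_le v)

theorem outDegAfter_le (k : Fin m) (v : Fin n) : G.outDegAfter k v ≤ 2 * n :=
  (Finset.card_le_card fun j hj => by simp at hj ⊢; exact Or.inl hj.2).trans
    (G.card_incident_le v)

theorem size_le {n m : ℕ} (G : EdgeStream n m) : m ≤ n ^ 2 := by
  have := Fintype.card_le_of_injective _ G.injective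
  simpa [sq] using this

end EdgeStream

/-! ### Expectation and variance of the estimate -/

/-- The sketch for the degree classes `α` of heads and `β` of tails. -/
noncomputable def classParams {ε : ℝ} {n : ℕ} (hε : 0 < ε) (hn : 2 ≤ n) (α β : ℕ) :
    SketchParams n where
  lo c := degThreshold ε n (if c then α else β)
  W c := classEnd ε n (if c then α else β)
  one_le_lo _ := one_le_degThreshold hε hn _
  lo_le _ := degThreshold_le_classEnd hε hn _
  W_le _ := classEnd_le hε hn _

/-- The pseudobias computed from a count and the degrees after the edge. -/
noncomputable def recordBias (κ : ℕ) (D : ℕ) (b : ℕ) {n : ℕ}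
    (z : ZMod (2 * n + 1) × ZMod (2 * n + 1)) (g : ℝ) : ℝ :=
  min (2 * ((2 * (D : ℝ) / κ * (b : ℝ) + (z.2.val : ℝ)) / ((D : ℝ) + (z.1.val : ℝ))) - 1 + g) 1

open scoped Classical in
/-- The estimate of an entry of the pseudosnapshot made after a detection. -/
noncomputable def recordEstimate (κ M Dα Dβ : ℕ) {n ℓ : ℕ} (t : Fin ℓ → ℝ) (d : Record n κ)
    (x y : ℝ) (i j : Fin ℓ) : ℝ :=
  if InBiasClass t i (recordBias κ Dα d.2.1.1 (d.2.2 true) x) ∧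
      InBiasClass t j (recordBias κ Dβ d.2.1.2.1 (d.2.2 false) y) then
    sgn d.2.1.2.2 * (72 * κ * M) else 0

theorem abs_recordEstimate_le (κ M Dα Dβ : ℕ) {n ℓ : ℕ} (t : Fin ℓ → ℝ) (d : Record n κ)
    (x y : ℝ) (i j : Fin ℓ) : |recordEstimate κ M Dα Dβ t d x y i j| ≤ 72 * κ * M := by
  unfold recordEstimate
  split_ifs
  · rw [abs_mul, abs_of_nonneg (by positivity : (0 : ℝ) ≤ 72 * κ * M)]
    unfold sgn
    split_ifs <;> simp
  · rw [abs_zero]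
    positivity

/-! ### Second moment of one detection -/

namespace SketchParams

variable {n κ M : ℕ} (S : SketchParams n)

theorem hit_sq (past : List (HashedEdge n)) (c : Bool) (w : Fin n) (b : ℕ) :
    S.hit past c w b ^ 2 = S.hit past c w b := by
  unfold hit
  split_ifs <;> simp

theorem sum_hit_le (past : List (HashedEdge n)) (c : Bool) (w : Fin n) :
    ∑ b : Fin κ, S.hit past c w b ≤ 1 := by
  have h : ∀ b : Fin κ, S.hit past c w b ≤ if (b : ℕ) = (hist c w past).count true then 1 else 0 :=
    fun b => by
      unfold hit
      split_ifs with h1 h2 h2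
      · exact le_rfl
      · exact absurd h1.2 h2
      · exact zero_le_one
      · exact le_rfl
  refine (Finset.sum_le_sum fun b _ => h b).trans ?_
  rw [Finset.sum_boole]
  have : (Finset.univ.filter fun b : Fin κ => (b : ℕ) = (hist c w past).count true).card ≤ 1 :=
    Finset.card_le_one.2 fun a ha b hb =>
      Fin.ext ((Finset.mem_filter.1 ha).2.trans (Finset.mem_filter.1 hb).2.symm)
  exact_mod_cast this

/-- Each term is at most `36 κ M` times the sum of the two indicators, where 36 is `2 * 72 ^ 2 /
288`. Summing over the guesses for the other endpoint and the sign gives another `4 κ`, since each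
endpoint has at most one true count. -/
theorem stepMean_sq_le (hκ : 1 ≤ κ) (hM : 1 ≤ M) (X : Record n κ → ℝ)
    (hX : ∀ d, |X d| ≤ 72 * κ * M) (past : List (HashedEdge n)) (t : HashedEdge n)
    (l : List (HashedEdge n)) :
    S.stepMean M (fun d => X d ^ 2) past t l ≤ 144 * (κ : ℝ) ^ 2 * M := by
  have hκ' : (0 : ℝ) < κ := by exact_mod_cast hκ
  have hM' : (0 : ℝ) < M := by exact_mod_cast hM
  set A : Fin κ → ℝ := fun b => S.hit (t :: past) true t.1.1 b with hA
  set B : Fin κ → ℝ := fun b => S.hit (t :: past) false t.1.2 b with hB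
  have hterm : ∀ J : Fin κ × Fin κ × Bool, 1 / (288 * κ * M) *
      (A J.1 + sgn J.2.2 * B J.2.1) ^ 2 * X (l.foldl Record.update (t.1, J, 0)) ^ 2 ≤
      36 * κ * M * (A J.1 + B J.2.1) := by
    intro J
    have h1 : (A J.1 + sgn J.2.2 * B J.2.1) ^ 2 ≤ 2 * (A J.1 + B J.2.1) := by
      have hs : sgn J.2.2 ^ 2 = 1 := by unfold sgn; split_ifs <;> norm_num
      have ha : A J.1 ^ 2 = A J.1 := S.hit_sq _ _ _ _
      have hb : B J.2.1 ^ 2 = B J.2.1 := S.hit_sq _ _ _ _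
      have hb' : (sgn J.2.2 * B J.2.1) ^ 2 = B J.2.1 := by rw [mul_pow, hs, one_mul, hb]
      linarith [sq_nonneg (A J.1 - sgn J.2.2 * B J.2.1),
        add_sq (A J.1) (sgn J.2.2 * B J.2.1), sub_sq (A J.1) (sgn J.2.2 * B J.2.1)]
    have h2 : X (l.foldl Record.update (t.1, J, 0)) ^ 2 ≤ (72 * κ * M) ^ 2 :=
      sq_le_sq' (abs_le.1 (hX _)).1 (abs_le.1 (hX _)).2
    have h3 : 0 ≤ 1 / (288 * κ * M : ℝ) * (2 * (A J.1 + B J.2.1)) :=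
      mul_nonneg (by positivity) ((sq_nonneg _).trans h1)
    calc _ ≤ 1 / (288 * κ * M) * (2 * (A J.1 + B J.2.1)) * (72 * κ * M) ^ 2 := by gcongr
      _ = _ := by field_simp; ring
  refine (Finset.sum_le_sum fun J _ => hterm J).trans ?_
  have hAs : ∑ b, A b ≤ 1 := S.sum_hit_le _ _ _
  have hBs : ∑ b, B b ≤ 1 := S.sum_hit_le _ _ _
  rw [← Finset.mul_sum]
  have e : ∑ J : Fin κ × Fin κ × Bool, (A J.1 + B J.2.1) = 2 * κ * (∑ b, A b + ∑ b, B b) := by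
    simp only [Fintype.sum_prod_type, Finset.sum_add_distrib, Finset.sum_const, Finset.card_univ,
      Fintype.card_fin, Fintype.card_bool, Fintype.card_prod, nsmul_eq_mul, ← Finset.mul_sum]
    push_cast
    ring
  rw [e]
  calc 36 * (κ : ℝ) * M * (2 * κ * (∑ b, A b + ∑ b, B b)) ≤ 36 * κ * M * (2 * κ * (1 + 1)) := by
        gcongr
    _ = _ := by ring

end SketchParams

/-- Polarization: the signed sum removes the squares and keeps the cross term, which detects both
endpoints jointly. -/
theorem sum_sgn_mul_sq (x y V : ℝ) : ∑ σ, (x + sgn σ * y) ^ 2 * (sgn σ * V) = 4 * x * y * V := by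
  rw [Fintype.sum_bool]
  simp only [sgn, if_true, Bool.false_eq_true, if_false]
  ring

theorem sum_fin_indicator (κ a : ℕ) (p : Prop) [Decidable p] (F : ℕ → ℝ) :
    ∑ b : Fin κ, (if p ∧ (b : ℕ) = a then 1 else 0) * F b = if p ∧ a < κ then F a else 0 := by
  by_cases hp : p
  · by_cases ha : a < κ
    · rw [Finset.sum_eq_single ⟨a, ha⟩]
      · simp [hp, ha]
      · intro b _ hb
        rw [if_neg, zero_mul]
        exact fun hc => hb (Fin.ext hc.2)
      · simp
    · rw [if_neg (fun hc => ha hc.2)]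
      refine Finset.sum_eq_zero fun b _ => ?_
      rw [if_neg, zero_mul]
      have := b.2
      omega
  · simp [hp]

/-! ### Mean contribution of one edge -/

namespace EdgeStream

variable {n m κ : ℕ} (G : EdgeStream n m)

theorem pseudoOutDeg_eq {ε : ℝ} (hε : 0 < ε) (hn : 2 ≤ n) {f : ℕ → Fin n × Fin n → Bool} {i : ℕ}
    (hi : i ≤ lastLevel ε n) {k : Fin m} {v : Fin n} (h : InDegreeClass ε n i (G.degUpTo k v)) :
    G.pseudoOutDeg κ ε f k v = 2 * (degThreshold ε n i : ℝ) / κ * (G.sampled f i k v : ℝ) := by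
  rw [pseudoOutDeg, pseudoDeg, degLevel_eq hε hn hi h, sampled]

/-- Later degrees are at most `2 n`, so their residues modulo `2 n + 1` determine them. -/
theorem pseudoBias_eq {ε : ℝ} (hε : 0 < ε) (hn : 2 ≤ n) {f : ℕ → Fin n × Fin n → Bool} {i : ℕ}
    (hi : i ≤ lastLevel ε n) {k : Fin m} {v : Fin n} (h : InDegreeClass ε n i (G.degUpTo k v))
    (g : Fin n → ℝ) :
    G.pseudoBias κ ε f g k v = recordBias κ (degThreshold ε n i) (G.sampled f i k v)
      (((G.degAfter k v : ℕ) : ZMod (2 * n + 1)), ((G.outDegAfter k v : ℕ) : ZMod (2 * n + 1)))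
      (g v) := by
  rw [pseudoBias, G.pseudoOutDeg_eq hε hn hi h, pseudoDeg, degLevel_eq hε hn hi h, recordBias,
    ZMod.val_natCast_of_lt (Nat.lt_succ_of_le (G.degAfter_le k v)),
    ZMod.val_natCast_of_lt (Nat.lt_succ_of_le (G.outDegAfter_le k v))]

theorem mul_pseudoOutDeg_add_one {ε : ℝ} (hε : 0 < ε) (hn : 2 ≤ n) (hκ : 1 ≤ κ)
    {f : ℕ → Fin n × Fin n → Bool} {i : ℕ}
    (hi : i ≤ lastLevel ε n) {k : Fin m} {v : Fin n} (h : InDegreeClass ε n i (G.degUpTo k v)) :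
    (κ : ℝ) / (2 * degThreshold ε n i) * G.pseudoOutDeg κ ε f k v + 1 =
      ((G.sampled f i k v + 1 : ℕ) : ℝ) := by
  have hκ' : (κ : ℝ) ≠ 0 := by positivity
  have hd : (degThreshold ε n i : ℝ) ≠ 0 := by
    have := one_le_degThreshold hε hn i
    positivity
  rw [G.pseudoOutDeg_eq hε hn hi h]
  push_cast
  field_simp

theorem hit_eq {ε : ℝ} (hε : 0 < ε) (hn : 2 ≤ n) (f : ℕ → Fin n × Fin n → Bool) (α β : ℕ)
    (k : Fin m) (c : Bool) (w : Fin n) (b : ℕ) :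
    (classParams hε hn α β).hit (G.upTo f α β k) c w b =
      open scoped Classical in
      if InDegreeClass ε n (if c then α else β) (G.degUpTo k w) ∧
        b = G.sampled f (if c then α else β) k w then 1 else 0 := by
  rw [SketchParams.hit, length_hist, count_hist]
  congr 1
  rw [inDegreeClass_iff (G.degUpTo_le k w)]
  rfl

/-- The later degree and out-degree of an endpoint, as kept in a record. -/
def later (k : Fin m) (c : Bool) : ZMod (2 * n + 1) × ZMod (2 * n + 1) :=
  (((G.degAfter k (endpoint (G.edge k) c) : ℕ) : ZMod (2 * n + 1)),
    ((G.outDegAfter k (endpoint (G.edge k) c) : ℕ) : ZMod (2 * n + 1)))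

theorem foldl_update_eq (f : ℕ → Fin n × Fin n → Bool) (α β : ℕ) (k : Fin m)
    (J : Fin κ × Fin κ × Bool) :
    ((List.ofFn (G.token f α β)).drop (k + 1)).foldl Record.update
      (((G.token f α β k).1, J, 0) : Record n κ) = (G.edge k, J, G.later k) := by
  rw [Record.foldl_update]
  refine Prod.ext rfl (Prod.ext rfl (funext fun c => ?_))
  simp only [countP_incident, countP_head, Pi.zero_apply, zero_add]
  rfl

-- The degree and count indicators select the true pair of counts, provided both are below `κ`; for
-- edges of the class this proviso is exactly the absence of overflow.
open scoped Classical in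
theorem stepMean_eq {ε : ℝ} (hε : 0 < ε) (hn : 2 ≤ n) (hκ : 1 ≤ κ) {M : ℕ} (hM : 1 ≤ M)
    (f : ℕ → Fin n × Fin n → Bool) (g : Fin n → ℝ) {α β : ℕ} (hα : α ≤ lastLevel ε n)
    (hβ : β ≤ lastLevel ε n) {ℓ : ℕ} (t : Fin ℓ → ℝ) (i j : Fin ℓ) (k : Fin m) :
    (classParams hε hn α β).stepMean M (fun d : Record n κ => recordEstimate κ M
      (degThreshold ε n α) (degThreshold ε n β) t d (g d.1.1) (g d.1.2) i j)
      ((List.ofFn (G.token f α β)).take k).reverse (G.token f α β k)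
      ((List.ofFn (G.token f α β)).drop (k + 1)) =
    if (k ∈ G.classEdges ε α β ∧ k ∉ G.overflowEdges κ ε f α β) ∧
      InBiasClass t i (G.pseudoBias κ ε f g k (G.edge k).1) ∧
      InBiasClass t j (G.pseudoBias κ ε f g k (G.edge k).2) then 1 else 0 := by
  have hκ' : (κ : ℝ) ≠ 0 := by positivity
  have hM' : (M : ℝ) ≠ 0 := by positivity
  set u := (G.edge k).1 with hu
  set v := (G.edge k).2 with hv
  set P : ℕ → ℕ → ℝ := fun b b' =>
    if InBiasClass t i (recordBias κ (degThreshold ε n α) b (G.later k true) (g u)) ∧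
      InBiasClass t j (recordBias κ (degThreshold ε n β) b' (G.later k false) (g v)) then 1 else 0
    with hP
  have e1 : (classParams hε hn α β).stepMean M (fun d : Record n κ => recordEstimate κ M
      (degThreshold ε n α) (degThreshold ε n β) t d (g d.1.1) (g d.1.2) i j)
      ((List.ofFn (G.token f α β)).take k).reverse (G.token f α β k)
      ((List.ofFn (G.token f α β)).drop (k + 1)) =
      ∑ b : Fin κ, (if InDegreeClass ε n α (G.degUpTo k u) ∧ (b : ℕ) = G.sampled f α k u
        then 1 else 0) * ∑ b' : Fin κ, (if InDegreeClass ε n β (G.degUpTo k v) ∧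
        (b' : ℕ) = G.sampled f β k v then 1 else 0) * P b b' := by
    rw [SketchParams.stepMean, Fintype.sum_prod_type]
    refine Finset.sum_congr rfl fun b _ => ?_
    rw [Fintype.sum_prod_type, Finset.mul_sum]
    refine Finset.sum_congr rfl fun b' _ => ?_
    simp only [cons_take_reverse, foldl_update_eq, hit_eq, recordEstimate]
    simp only [if_true, Bool.false_eq_true, if_false]
    have h0 : ∀ (σ : Bool) (x y : ℝ), 1 / (288 * κ * M : ℝ) * (x + sgn σ * y) ^ 2 *
        (if InBiasClass t i (recordBias κ (degThreshold ε n α) b (G.later k true) (g u)) ∧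
          InBiasClass t j (recordBias κ (degThreshold ε n β) b' (G.later k false) (g v)) then
        sgn σ * (72 * κ * M) else 0) =
        1 / (288 * κ * M : ℝ) * ((x + sgn σ * y) ^ 2 * (sgn σ * (72 * κ * M * P b b'))) := by
      intro σ x y
      simp only [hP]
      split_ifs <;> ring
    refine (Finset.sum_congr rfl fun σ _ => h0 σ _ _).trans ?_
    -- The scale 72 is chosen here: `4 * 72 = 288` cancels the denominator and leaves the bare
    -- product of indicators.
    rw [← Finset.mul_sum, sum_sgn_mul_sq]
    simp only [token, ← hu, ← hv]
    field_simp
    ring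
  rw [e1]
  have e2 : ∀ b : ℕ, ∑ b' : Fin κ, (if InDegreeClass ε n β (G.degUpTo k v) ∧
      (b' : ℕ) = G.sampled f β k v then 1 else 0) * P b b' =
      if InDegreeClass ε n β (G.degUpTo k v) ∧ G.sampled f β k v < κ
        then P b (G.sampled f β k v) else 0 := fun b => sum_fin_indicator κ _ _ (fun b' => P b b')
  simp only [e2]
  rw [sum_fin_indicator κ _ _ (fun b => if InDegreeClass ε n β (G.degUpTo k v) ∧
    G.sampled f β k v < κ then P b (G.sampled f β k v) else 0)]
  by_cases hcls : k ∈ G.classEdges ε α β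
  · have h12 : InDegreeClass ε n α (G.degUpTo k u) ∧ InDegreeClass ε n β (G.degUpTo k v) := by
      simpa [classEdges] using hcls
    obtain ⟨h1, h2⟩ := h12
    have hov : k ∉ G.overflowEdges κ ε f α β ↔ G.sampled f α k u < κ ∧ G.sampled f β k v < κ := by
      rw [overflowEdges, Finset.mem_filter, ← hu, ← hv,
        G.mul_pseudoOutDeg_add_one hε hn hκ hα h1, G.mul_pseudoOutDeg_add_one hε hn hκ hβ h2,
        lt_max_iff, Nat.cast_lt, Nat.cast_lt]
      constructor
      · intro h
        by_contra hc
        exact h ⟨hcls, by omega⟩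
      · rintro h ⟨-, h'⟩
        omega
    rw [G.pseudoBias_eq hε hn hα h1, G.pseudoBias_eq hε hn hβ h2]
    simp only [h1, h2, true_and, hcls, hov]
    rw [hP, ← ite_and, ← ite_and]
    congr 1
  · have h12 : ¬ (InDegreeClass ε n α (G.degUpTo k u) ∧ InDegreeClass ε n β (G.degUpTo k v)) := by
      simpa [classEdges] using hcls
    rw [← ite_and, if_neg (fun h => h12 ⟨h.1.1, h.2.1⟩), if_neg (fun h => hcls h.1.1)]

/-- One block per edge gives `m ≤ κ m`; the sampled edges give at most `7 * 2 κ m`. Together this is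
`15 κ m`. -/
theorem sum_cost_le {ε : ℝ} (hε : 0 < ε) (hε1 : ε ≤ 1) (hn : 2 ≤ n) (hκ : 1 ≤ κ)
    (f : ℕ → Fin n × Fin n → Bool) (α β : ℕ)
    (h : ∑ k, ((degThreshold ε n α : ℝ) * (if f α (G.edge k) = true then 1 else 0) +
              (degThreshold ε n β : ℝ) * (if f β (G.edge k) = true then 1 else 0))
            ≤ 2 * κ * m) :
    ((List.ofFn (G.token f α β)).map (classParams hε hn α β).cost).sum ≤ 15 * κ * m := by
  rw [List.map_ofFn, List.sum_ofFn]
  have hb : ∀ b : Bool, (b.toNat : ℝ) = if b = true then 1 else 0 := by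
    intro b
    cases b <;> simp
  have hα := classEnd_le_mul hε hε1 hn α
  have hβ := classEnd_le_mul hε hε1 hn β
  have h1 : ∀ k, (((classParams hε hn α β).cost (G.token f α β k) : ℕ) : ℝ) ≤
      1 + 7 * ((degThreshold ε n α : ℝ) * (if f α (G.edge k) = true then 1 else 0) +
              (degThreshold ε n β : ℝ) * (if f β (G.edge k) = true then 1 else 0)) := by
    intro k
    rw [← hb, ← hb]
    have h2 : (classParams hε hn α β).cost (G.token f α β k) ≤
        1 + 7 * (degThreshold ε n α * (f α (G.edge k)).toNat +
          degThreshold ε n β * (f β (G.edge k)).toNat) := by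
      have e : (classParams hε hn α β).cost (G.token f α β k) =
        1 + classEnd ε n α * (f α (G.edge k)).toNat + classEnd ε n β * (f β (G.edge k)).toNat := rfl
      rw [e]
      nlinarith [Nat.mul_le_mul_right (f α (G.edge k)).toNat hα,
        Nat.mul_le_mul_right (f β (G.edge k)).toNat hβ]
    exact_mod_cast h2
  have h3 : ((∑ k, (classParams hε hn α β).cost (G.token f α β k) : ℕ) : ℝ) ≤
      ((15 * κ * m : ℕ) : ℝ) := by
    push_cast
    refine (Finset.sum_le_sum fun k _ => h1 k).trans ?_
    rw [Finset.sum_add_distrib, ← Finset.mul_sum]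
    simp only [Finset.sum_const, Finset.card_univ, Fintype.card_fin, nsmul_eq_mul, mul_one]
    have : (m : ℝ) ≤ κ * m := le_mul_of_one_le_left (by positivity) (by exact_mod_cast hκ)
    linarith
  exact_mod_cast h3

end EdgeStream

/-! ### Space bounds and the final assembly -/

theorem clog_two_le_of_le_pow {n x K : ℕ} (h : x ≤ n ^ K) : Nat.clog 2 x ≤ K * Nat.clog 2 n := by
  refine Nat.clog_le_of_le_pow (h.trans ?_)
  rw [mul_comm, pow_mul]
  exact Nat.pow_le_pow_left (Nat.le_pow_clog one_lt_two n) K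

theorem clog_two_le_log {n : ℕ} (hn : 2 ≤ n) :
    (Nat.clog 2 n : ℝ) ≤ 2 / Real.log 2 * Real.log n := by
  have hl : 0 < Real.log 2 := Real.log_pos one_lt_two
  have h1 : Real.log 2 ≤ Real.log n := Real.log_le_log two_pos (by exact_mod_cast hn)
  have h2 : (2 : ℝ) ^ (Nat.clog 2 n).pred ≤ n := by
    exact_mod_cast (Nat.pow_pred_clog_lt_self one_lt_two (by omega : 1 < n)).le
  have h3 := Real.log_le_log (by positivity) h2
  rw [Real.log_pow] at h3
  have h4 : (Nat.clog 2 n : ℝ) ≤ ((Nat.clog 2 n).pred : ℝ) + 1 := by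
    exact_mod_cast Nat.le_succ_of_pred_le le_rfl
  rw [div_mul_eq_mul_div, le_div_iff₀ hl]
  nlinarith

theorem card_sketchLabel_le {n κ M c : ℕ} (hn : 2 ≤ n) (hκ : κ ≤ n ^ c)
    (hM : M ≤ 15 * κ * n ^ 2 + 1) : Fintype.card (SketchLabel n κ M) ≤ n ^ (c + 11) := by
  have hcard : Fintype.card (SketchLabel n κ M) = M * 24 + 12 * (n * ((2 * n + 1) * κ)) := by
    simp only [Fintype.card_sum, Fintype.card_prod, Fintype.card_fin, Fintype.card_bool,
      Fintype.card_option]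
    ring
  -- Since `n ≥ 2`, numerical constants are absorbed into powers of `n`.
  have h9 : 2 ^ 9 ≤ n ^ 9 := Nat.pow_le_pow_left hn 9
  have h1 : 1 ≤ n ^ c * n ^ 2 := Nat.one_le_iff_ne_zero.2 (by positivity)
  have h2 : κ * n ^ 2 ≤ n ^ c * n ^ 2 := Nat.mul_le_mul_right _ hκ
  have h3 : n * ((2 * n + 1) * κ) ≤ 3 * (κ * n ^ 2) := by nlinarith [Nat.zero_le (n * κ)]
  calc Fintype.card (SketchLabel n κ M) ≤ 2 ^ 9 * (n ^ c * n ^ 2) := by rw [hcard]; nlinarith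
    _ ≤ n ^ 9 * (n ^ c * n ^ 2) := Nat.mul_le_mul_right _ h9
    _ = n ^ (c + 11) := by ring

theorem card_record_le {n κ c : ℕ} (hn : 2 ≤ n) (hκ : κ ≤ n ^ c) :
    Fintype.card (Record n κ) + 2 ≤ n ^ (2 * c + 14) := by
  have hcard : Fintype.card (Record n κ) = n * n * (κ * (κ * 2) * ((2 * n + 1) ^ 2) ^ 2) := by
    simp only [Fintype.card_prod, Fintype.card_fin, Fintype.card_bool, Fintype.card_fun, ZMod.card]
    ring
  have h8 : 2 ^ 8 ≤ n ^ 8 := Nat.pow_le_pow_left hn 8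
  have h1 : 1 ≤ n ^ 2 * ((n ^ c) ^ 2 * n ^ 4) := Nat.one_le_iff_ne_zero.2 (by positivity)
  calc Fintype.card (Record n κ) + 2
      ≤ n * n * (n ^ c * (n ^ c * 2) * ((3 * n) ^ 2) ^ 2) + 2 := by
        rw [hcard]
        gcongr
        omega
    _ = 162 * (n ^ 2 * ((n ^ c) ^ 2 * n ^ 4)) + 2 := by ring
    _ ≤ 2 ^ 8 * (n ^ 2 * ((n ^ c) ^ 2 * n ^ 4)) := by omega
    _ ≤ n ^ 8 * (n ^ 2 * ((n ^ c) ^ 2 * n ^ 4)) := Nat.mul_le_mul_right _ h8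
    _ = n ^ (2 * c + 14) := by ring

-- The mean differs from the pseudosnapshot only by omitting overflow edges, each of weight at most
-- one.
open scoped Classical in
theorem EdgeStream.abs_sum_sub_pseudoSnapshot_le {n m κ : ℕ} (G : EdgeStream n m) (ε : ℝ)
    (f : ℕ → Fin n × Fin n → Bool) (g : Fin n → ℝ) (α β : ℕ) {ℓ : ℕ} (t : Fin ℓ → ℝ)
    (i j : Fin ℓ) :
    |(∑ k, if (k ∈ G.classEdges ε α β ∧ k ∉ G.overflowEdges κ ε f α β) ∧
      InBiasClass t i (G.pseudoBias κ ε f g k (G.edge k).1) ∧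
      InBiasClass t j (G.pseudoBias κ ε f g k (G.edge k).2) then (1 : ℝ) else 0) -
      (G.pseudoSnapshot κ ε f g t (G.classEdges ε α β) i j : ℝ)| ≤
    ((G.overflowEdges κ ε f α β).card : ℝ) := by
  have h1 : (G.pseudoSnapshot κ ε f g t (G.classEdges ε α β) i j : ℝ) =
      ∑ k, if k ∈ G.classEdges ε α β ∧ InBiasClass t i (G.pseudoBias κ ε f g k (G.edge k).1) ∧
        InBiasClass t j (G.pseudoBias κ ε f g k (G.edge k).2) then (1 : ℝ) else 0 := by
    rw [pseudoSnapshot, Finset.sum_boole]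
    congr 2
    ext k
    simp
  have h2 : ((G.overflowEdges κ ε f α β).card : ℝ) =
      ∑ k, if k ∈ G.overflowEdges κ ε f α β then (1 : ℝ) else 0 := by
    rw [Finset.sum_boole]
    simp
  rw [h1, h2, ← Finset.sum_sub_distrib]
  refine (Finset.abs_sum_le_sum_abs _ _).trans (Finset.sum_le_sum fun k _ => ?_)
  by_cases ho : k ∈ G.overflowEdges κ ε f α β
  · simp only [ho, not_true_eq_false, and_false, false_and, if_false, if_true, zero_sub, abs_neg]
    split_ifs <;> simp
  · simp [ho]

theorem mainTheorem2 :
    ∃ Cvar : ℝ, ∀ c : ℕ, ∃ Cspace : ℝ,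
      ∀ (n m κ : ℕ) (ε : ℝ), 2 ≤ n → 1 ≤ κ → κ ≤ n ^ c → 0 < ε → ε ≤ 1 →
      ∀ α β : ℕ, α ≤ lastLevel ε n → β ≤ lastLevel ε n →
      ∀ (ℓ : ℕ) (t : Fin ℓ → ℝ), (∀ i, t i ∈ Set.Icc (-1 : ℝ) 1) →
      ∃ (A : QuantumStreamAlg ((Fin n × Fin n) × Bool × Bool))
        (query : A.Mem → Fin n × Fin n)
        (estimate : A.Mem → ℝ → ℝ → Matrix (Fin ℓ) (Fin ℓ) ℝ),
        (A.space : ℝ) ≤ Cspace * Real.log n ∧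
        ∀ (f : ℕ → Fin n × Fin n → Bool) (g : Fin n → ℝ) (G : EdgeStream n m),
          (∀ v, g v ∈ Set.Icc (-ε) ε) →
          (∑ k, ((degThreshold ε n α : ℝ) * (if f α (G.edge k) = true then 1 else 0) +
              (degThreshold ε n β : ℝ) * (if f β (G.edge k) = true then 1 else 0))
            ≤ 2 * κ * m) →
          ∀ i j : Fin ℓ,
            |A.mean (G.hashedStream f α β)
                (fun o => estimate o (g (query o).1) (g (query o).2) i j) -
              (G.pseudoSnapshot κ ε f g t (G.classEdges ε α β) i j : ℝ)|
              ≤ ((G.overflowEdges κ ε f α β).card : ℝ) ∧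
            A.variance (G.hashedStream f α β)
                (fun o => estimate o (g (query o).1) (g (query o).2) i j)
              ≤ Cvar * (κ : ℝ) ^ 3 * (m : ℝ) ^ 2 := by
  -- `2304 = 144 * 16`, from the second moment per edge and `M ≤ 16 κ m`. The factor `3 c + 25` adds
  -- the exponents `c + 11` for labels and `2 c + 14` for records.
  refine ⟨2304, fun c => ⟨(3 * c + 25) * (2 / Real.log 2), ?_⟩⟩
  intro n m κ ε hn hκ hκn hε hε1 α β hα hβ ℓ t _
  -- The algorithm exists for every `m`, even when no graph has `m` edges; the minimum keeps its
  -- space logarithmic in `n`. The added 1 makes the initial state nonempty.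
  set M := 15 * κ * min m (n ^ 2) + 1 with hM
  have hM1 : 1 ≤ M := by omega
  obtain ⟨A, dec, hA, hmean⟩ := (classParams hε hn α β).exists_alg hκ hM1
  -- Without a detection the queried vertices are arbitrary, because the estimate is then zero.
  refine ⟨A, fun o => (dec o).elim (⟨0, by omega⟩, ⟨0, by omega⟩) (fun d => d.1),
    fun o x y i j => (dec o).elim 0 (fun d => recordEstimate κ M (degThreshold ε n α)
      (degThreshold ε n β) t d x y i j), ?_, ?_⟩
  · have h1 : A.space ≤ (3 * c + 25) * Nat.clog 2 n := by
      rw [hA]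
      have hM' : M ≤ 15 * κ * n ^ 2 + 1 :=
        Nat.add_le_add_right (Nat.mul_le_mul_left _ (min_le_right _ _)) _
      have h1 := clog_two_le_of_le_pow (card_sketchLabel_le hn hκn hM')
      have h2 := clog_two_le_of_le_pow (card_record_le hn hκn)
      nlinarith
    calc (A.space : ℝ) ≤ (3 * c + 25) * (Nat.clog 2 n : ℝ) := by exact_mod_cast h1
      _ ≤ (3 * c + 25) * (2 / Real.log 2 * Real.log n) := by
        gcongr
        exact clog_two_le_log hn
      _ = _ := by ring
  · intro f g G _ hsum i j
    have hcost : ((List.ofFn (G.token f α β)).map (classParams hε hn α β).cost).sum ≤ M := by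
      refine (G.sum_cost_le hε hε1 hn hκ f α β hsum).trans ?_
      rw [hM, min_eq_left G.size_le]
      omega
    set X : Record n κ → ℝ := fun d => recordEstimate κ M (degThreshold ε n α)
      (degThreshold ε n β) t d (g d.1.1) (g d.1.2) i j with hX
    have hX' : ∀ (Y : ℝ → ℝ), Y 0 = 0 → (fun o => Y ((dec o).elim 0 (fun d => recordEstimate κ M
        (degThreshold ε n α) (degThreshold ε n β) t d
        (g ((dec o).elim (⟨0, by omega⟩, ⟨0, by omega⟩) (fun d => d.1)).1)
        (g ((dec o).elim (⟨0, by omega⟩, ⟨0, by omega⟩) (fun d => d.1)).2) i j))) =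
        fun o => (dec o).elim 0 (fun d => Y (X d)) := fun Y hY => by
      ext o
      rcases dec o with _ | d
      · exact hY
      · rfl
    have hstream : G.hashedStream f α β = List.ofFn (G.token f α β) := rfl
    constructor
    · have e1 := hX' id rfl
      simp only [id] at e1
      rw [e1, hstream, hmean _ _ hcost]
      rw [sum_length_ofFn (G.token f α β) (fun k s => (classParams hε hn α β).stepMean M X
        ((List.ofFn (G.token f α β)).take k).reverse s
        ((List.ofFn (G.token f α β)).drop (k + 1)))]
      simp only [hX, G.stepMean_eq hε hn hκ hM1 f g hα hβ t i j]
      exact G.abs_sum_sub_pseudoSnapshot_le ε f g α β t i j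
    · refine (A.variance_le_mean_sq _ _).trans ?_
      have e2 := hX' (fun x => x ^ 2) (by norm_num)
      simp only at e2
      rw [e2, hstream, hmean _ _ hcost]
      rw [sum_length_ofFn (G.token f α β) (fun k s => (classParams hε hn α β).stepMean M
        (fun d => X d ^ 2) ((List.ofFn (G.token f α β)).take k).reverse s
        ((List.ofFn (G.token f α β)).drop (k + 1)))]
      have hb : ∀ d, |X d| ≤ 72 * κ * M := fun d => abs_recordEstimate_le _ _ _ _ _ _ _ _ _ _
      refine (Finset.sum_le_sum fun k _ =>
        (classParams hε hn α β).stepMean_sq_le hκ hM1 X hb _ _ _).trans ?_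
      rw [Finset.sum_const, Finset.card_univ, Fintype.card_fin, nsmul_eq_mul]
      -- The bound `M ≤ 16 κ m` absorbs the added 1 and fails for `m = 0`; the extra factor `m`
      -- covers that case.
      have hMle : (m : ℝ) * M ≤ m * (16 * κ * m) := by
        rcases Nat.eq_zero_or_pos m with h0 | h0
        · simp [h0]
        · gcongr
          have h1 : M ≤ 16 * κ * m := by
            rw [hM, min_eq_left G.size_le]
            have := Nat.mul_pos (show 0 < κ from hκ) h0
            nlinarith
          exact_mod_cast h1
      calc (m : ℝ) * (144 * (κ : ℝ) ^ 2 * M) = 144 * (κ : ℝ) ^ 2 * (m * M) := by ring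
        _ ≤ 144 * (κ : ℝ) ^ 2 * (m * (16 * κ * m)) := by gcongr
        _ = _ := by ring
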